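/- **Setting.** Let $\mathcal P$ be a nonempty class of probability distributions of a pair $(X_i,W_i)\in\mathbb R^{d_X}\times\mathbb R^{d_W}$, let $\Theta\subseteq\mathbb R^d$, let $m:\mathbb R^{d_W}\times\Theta\to\mathbb R^{d_Y}$ be measurable, and let $\mathcal G$ be a class of measurable functions $g=(g_1,\dots,g_{d_Y}):\mathbb R^{d_X}\to\mathbb R^{d_Y}$. The identified set is $\Theta_0(P)=\{\theta\in\Theta: E_P[m(W_i,\theta)\mid X_i]\ge 0\ P\text{-a.s.}\}$, and $\bar m(\theta,x,P)$ denotes a version of $E_P[m(W_i,\theta)\mid X_i=x]$. From an iid sample $(X_1,W_1),\dots,(X_n,W_n)$ from $P$ form $\hat\mu_{n,j}(\theta,g)=\frac1n\sum_{i=1}^n m_j(W_i,\theta)g_j(X_i)$. For possibly data dependent weights $\omega_n(\theta,g)=(\omega_{n,1}(\theta,g),\dots,\omega_{n,d_Y}(\theta,g))$ and critical values $\hat c_n$, and a function $S:\mathbb R^{d_Y}\to[0,\infty)$, let $$T_{n,\omega}(\theta)=\sup_{g\in\mathcal G}S\big(\omega_{n,1}(\theta,g)\hat\mu_{n,1}(\theta,g),\dots,\omega_{n,d_Y}(\theta,g)\hat\mu_{n,d_Y}(\theta,g)\big),\qquad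 \mathcal C_{n,\omega}(\hat c_n)=\{\theta\in\Theta:\sqrt n\,T_{n,\omega}(\theta)\le\hat c_n\}.$$ Let $d(\theta,A)=\inf_{a\in A}\|\theta-a\|$, let $d_H$ be the Hausdorff distance for the Euclidean norm (possibly infinite), and let $\operatorname{supp}_P$ be the support of $X_i$ under $P$. Statements about possibly non-measurable events refer to inner probability in (a) and outer probability elsewhere. **Assumptions.** 1. For all $P\in\mathcal P$, $g\in\mathcal G$ and $j$: $g_j(X_i)\ge0$ $P$-a.s. 2. For some $\overline Y\ge0$: $|m_j(W_i,\theta)g_j(X_i)|\le\overline Y$ $P$-a.s. for all $P\in\mathcal P$, $\theta\in\Theta$, $g\in\mathcal G$ and $j$. 3. For each $j$ let $\mathcal F_{j,1}$ be the class of functions $s\,m_j(w,\theta)g_j(x)+t$ with $\theta\in\Theta$, $g\in\mathcal G$, $s,t\in[-(\overline Y\vee1),\overline Y\vee1]$, and $\mathcal F_{j,2}=\{f^2:f\in\mathcal F_{j,1}\}$. For some $A,V>0$: $\sup_QN(\varepsilon,\mathcal F_{j,i},L_1(Q))\le A\varepsilon^{-V}$ for all $0<\varepsilon<1$, all $j$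 and $i=1,2$, where $Q$ ranges over all probability measures and $N$ is the covering number (centers in $L_1(Q)$, not necessarily in the class). Moreover $\{m_j(w,\theta)g_j(x):\theta\in\Theta,g\in\mathcal G\}$ is a $P$-measurable class for each $P\in\mathcal P$ and $j$: for all $n$ and $e\in\mathbb R^n$, $\sup_{\theta,g}|\sum_{i=1}^n e_im_j(W_i,\theta)g_j(X_i)|$ is measurable with respect to the completion of $P^n$. 4. $S(t)>0$ if and only if $t_j<0$ for some $j$; and for some $K_{S,1},K_{S,2}>0$ and all $c>0$, $S(t)\ge c$ implies $t_j\le-cK_{S,1}$ for some $j$, and $S(t)\le c$ implies $t_j\ge-cK_{S,2}$ for all $j$. 5. For every $\varepsilon>0$ there is $\delta>0$ such that for all $P\in\mathcal P$ and $\theta\in\Theta$ with $d(\theta,\Theta_0(P))>\varepsilon$ there are $g\in\mathcal G$ and $j$ with $E_Pm_j(W_i,\theta)g_j(X_i)<-\delta$. 6. For $P\in\mathcal P$ and $x\in\operatorname{supp}_P$, $\bar m(\theta,x,P)$ is differentiable in $\theta\in\Theta$ (relative to $\Theta$) with derivative $\bar m_\theta(\theta,x,P)$, and $\bar m_\theta$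 is uniformly continuous in $\theta\in\Theta$, uniformly in $(x,P)$. 7. There are $\alpha>0$, $\eta>0$, $C>0$ such that for all $P\in\mathcal P$ and $\theta\in\Theta\setminus\Theta_0(P)$ there are $j_0=j_0(\theta,P)$, $\theta_0=\theta_0(\theta,P)\in\Theta_0(P)$ and $x_0=x_0(\theta,P)\in\operatorname{supp}_P$ with $\bar m_{j_0}(\theta_0,x_0,P)=0$ and, for all $x\in\operatorname{supp}_P$ with $\|x-x_0\|<\eta$, $$\bar m_{\theta,j_0}(\theta_0,x,P)(\theta-\theta_0)\le-\eta\|\theta-\theta_0\|,\qquad|\bar m_{j_0}(\theta_0,x,P)-\bar m_{j_0}(\theta_0,x_0,P)|\le C\|x-x_0\|^\alpha.$$ Moreover, for every $\varepsilon>0$ there is $\delta>0$ such that, for all $P\in\mathcal P$ and $\theta\in\Theta\setminus\Theta_0(P)$ with $d(\theta,\Theta_0(P))<\delta$, we have $\|\theta-\theta_0(\theta,P)\|<\varepsilon$ and the segment from $\theta_0(\theta,P)$ to $\theta$ lies in $\Theta$. 8. For some $\eta'>0$: $P(\|X_i-x\|\le\varepsilon)\ge\eta'\varepsilon^{d_X}$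 for all $P\in\mathcal P$, $0<\varepsilon\le1$ and $x\in\operatorname{supp}_P$. 9. The functions in $\mathcal G$ are uniformly bounded, and for some $0<C_{\mathcal G,1},C_{\mathcal G,2}<1$ and all $s\in\mathbb R^{d_X}$, $t\ge0$ there is $g\in\mathcal G$ with $C_{\mathcal G,1}I(\|X_i-s\|<C_{\mathcal G,2}t)\le g_j(X_i)\le I(\|X_i-s\|<t)$ for all $j$, $P$-a.s. for all $P\in\mathcal P$. 10. For some $0<\underline\omega\le\overline\omega<\infty$: $\underline\omega\le\omega_{n,j}(\theta,g)\le\overline\omega$ for all $n,j,\theta,g$. 11. $\hat c_n\to\infty$ and $\hat c_n/\sqrt n\to0$ in probability uniformly in $P\in\mathcal P$: $\sup_{P\in\mathcal P}P(\hat c_n<K)\to0$ for all $K$ and $\sup_{P\in\mathcal P}P(|\hat c_n/\sqrt n|>\epsilon)\to0$ for all $\epsilon>0$. (For deterministic $\hat c_n$ this is ordinary convergence.) **Conclusion.** Then (a) $\displaystyle\inf_{P\in\mathcal P}P\big(\Theta_0(P)\subseteq\mathcal C_{n,\omega}(\hat c_n)\big)\to1$ as $n\to\infty$, and (b) for all $B$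 large enough, $\displaystyle\sup_{P\in\mathcal P}P\Big(\big(n/\hat c_n^2\big)^{\alpha/(2d_X+2\alpha)}\,d_H\big(\mathcal C_{n,\omega}(\hat c_n),\Theta_0(P)\big)>B\Big)\to0$ as $n\to\infty$. -/

import Mathlib

open MeasureTheory Filter Topology Set
open scoped ENNReal NNReal

noncomputable section

namespace CondMoment

/-- `ℝ^k` with the Euclidean norm. -/
abbrev Vec (k : ℕ) : Type := EuclideanSpace ℝ (Fin k)

/-- The space of one observation `(X_i, W_i)`. -/
abbrev Obs (dX dW : ℕ) : Type := Vec dX × Vec dW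

/-- An instrument `g = (g_1, …, g_{dY})`, a vector of functions of the conditioning variable. -/
abbrev Instr (dX dY : ℕ) : Type := Vec dX → Fin dY → ℝ

/-- A conditional moment inequality model: a class `laws` of distributions of one observation,
a parameter space `Θ ⊆ ℝ^d`, a measurable moment function `m : ℝ^{dW} × Θ → ℝ^{dY}`
(its values for `θ ∉ Θ` are never used) and a class `𝒢` of measurable instruments. -/
structure Model (dX dW dY d : ℕ) where
  /-- the class of data generating processes -/
  laws : Set (ProbabilityMeasure (Obs dX dW))
  nonempty_laws : laws.Nonempty
  /-- the parameter space -/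
  Θ : Set (Vec d)
  /-- the moment function -/
  m : Vec dW → Vec d → Fin dY → ℝ
  measurable_m : Measurable (fun p : Vec dW × Θ => m p.1 p.2)
  /-- the class of instruments -/
  𝒢 : Set (Instr dX dY)
  measurable_𝒢 : ∀ g ∈ 𝒢, Measurable g

/-- The law of an iid sample of size `n` from `P`. -/
abbrev sampleLaw {dX dW : ℕ} (n : ℕ) (P : ProbabilityMeasure (Obs dX dW)) :
    Measure (Fin n → Obs dX dW) :=
  Measure.pi (fun _ : Fin n => (P : Measure (Obs dX dW)))

/-- Inner probability of an event; it is the probability when the event is measurable.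
(A measure applied to a set that need not be measurable is the outer measure.) -/
def innerProb {Ω : Type*} [MeasurableSpace Ω] (μ : Measure Ω) (s : Set Ω) : ℝ≥0∞ := 1 - μ sᶜ

/-- The support of `X_i` under `P`. -/
def suppX {dX dW : ℕ} (P : ProbabilityMeasure (Obs dX dW)) : Set (Vec dX) :=
  (Measure.map Prod.fst (P : Measure (Obs dX dW))).support

/-- The `L₁(Q)` covering number of `F`: the least number of centers in `L₁(Q)`, not necessarily
in `F`, such that every `f ∈ F` is within `ε` of a center in `L₁(Q)`. -/
def coveringNumber {Z : Type*} [MeasurableSpace Z] (ε : ℝ) (F : Set (Z → ℝ)) (Q : Measure Z) :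
    ℕ∞ :=
  ⨅ (C : Set (Z → ℝ)) (_ : (∀ h ∈ C, MemLp h 1 Q) ∧
    ∀ f ∈ F, ∃ h ∈ C, eLpNorm (f - h) 1 Q ≤ ENNReal.ofReal ε), C.encard

/-- `F` is a `P`-measurable class: for all `n` and all `e ∈ ℝ^n`, the function
`(z_1, …, z_n) ↦ sup_{f ∈ F} |∑ e_i f(z_i)|` is measurable on the completion of the
`n`-fold product of `P`. -/
def IsPMeasurableClass {Z : Type*} [MeasurableSpace Z] (F : Set (Z → ℝ)) (P : Measure Z) : Prop :=
  ∀ (n : ℕ) (e : Fin n → ℝ),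
    AEMeasurable (fun z : Fin n → Z => ⨆ f ∈ F, ENNReal.ofReal |∑ i, e i * f (z i)|)
      (Measure.pi (fun _ : Fin n => P))

namespace Model

variable {dX dW dY d : ℕ} (M : Model dX dW dY d)

/-- `m_j(W_i, θ) g_j(X_i)` as a function of the observation. -/
def moment (θ : Vec d) (g : Instr dX dY) (j : Fin dY) (z : Obs dX dW) : ℝ :=
  M.m z.2 θ j * g z.1 j

/-- `μ_{P,j}(θ, g) = E_P m_j(W_i, θ) g_j(X_i)`. -/
def mu (P : ProbabilityMeasure (Obs dX dW)) (θ : Vec d) (g : Instr dX dY) (j : Fin dY) : ℝ :=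
  ∫ z, M.moment θ g j z ∂(P : Measure (Obs dX dW))

/-- The sample analogue `E_n m_j(W_i, θ) g_j(X_i)`. -/
def muHat {n : ℕ} (z : Fin n → Obs dX dW) (θ : Vec d) (g : Instr dX dY) (j : Fin dY) : ℝ :=
  (n : ℝ)⁻¹ * ∑ i, M.moment θ g j (z i)

/-- The conditional expectation `E_P[m_j(W_i, θ) | X_i]`. -/
def condMoment (P : ProbabilityMeasure (Obs dX dW)) (θ : Vec d) (j : Fin dY) :
    Obs dX dW → ℝ :=
  (P : Measure (Obs dX dW))[fun z => M.m z.2 θ j |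
    MeasurableSpace.comap (Prod.fst : Obs dX dW → Vec dX) inferInstance]

/-- The identified set `Θ₀(P)`. -/
def identifiedSet (P : ProbabilityMeasure (Obs dX dW)) : Set (Vec d) :=
  {θ ∈ M.Θ | ∀ᵐ z ∂(P : Measure (Obs dX dW)), ∀ j, 0 ≤ M.condMoment P θ j z}

/-- `mbar P θ x` is a version of `E_P[m(W_i, θ) | X_i = x]`, for `P ∈ laws` and `θ ∈ Θ`. -/
def IsCondMean (mbar : ProbabilityMeasure (Obs dX dW) → Vec d → Vec dX → Fin dY → ℝ) : Prop :=
  ∀ P ∈ M.laws, ∀ θ ∈ M.Θ, ∀ j,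
    (fun z : Obs dX dW => mbar P θ z.1 j) =ᵐ[(P : Measure (Obs dX dW))] M.condMoment P θ j

/-- The KS statistic `sup_{g ∈ 𝒢} S(ω_1(θ,g) μ̂_1(θ,g), …, ω_{dY}(θ,g) μ̂_{dY}(θ,g))`. -/
def ksStat (S : (Fin dY → ℝ) → ℝ≥0) (ω : Vec d → Instr dX dY → Fin dY → ℝ)
    {n : ℕ} (z : Fin n → Obs dX dW) (θ : Vec d) : ℝ≥0∞ :=
  ⨆ g ∈ M.𝒢, (S (fun j => ω θ g j * M.muHat z θ g j) : ℝ≥0∞)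

/-- The set estimate: all `θ ∈ Θ` with `√n T(θ) ≤ c`. -/
def setEstimate (S : (Fin dY → ℝ) → ℝ≥0) (ω : Vec d → Instr dX dY → Fin dY → ℝ)
    {n : ℕ} (z : Fin n → Obs dX dW) (c : ℝ) : Set (Vec d) :=
  {θ ∈ M.Θ | ((ENNReal.ofReal (√(n : ℝ)) * M.ksStat S ω z θ : ℝ≥0∞) : EReal) ≤ (c : EReal)}

/-- The class `{m_j(W_i, θ) g_j(X_i) | θ ∈ Θ, g ∈ 𝒢}`. -/
def momentClass (j : Fin dY) : Set (Obs dX dW → ℝ) :=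
  {f | ∃ θ ∈ M.Θ, ∃ g ∈ M.𝒢, f = M.moment θ g j}

/-- The class `{s m_j(W_i, θ) g_j(X_i) + t | θ ∈ Θ, g ∈ 𝒢, s, t ∈ [-(Y ∨ 1), Y ∨ 1]}`. -/
def affineClass (Y : ℝ) (j : Fin dY) : Set (Obs dX dW → ℝ) :=
  {f | ∃ h ∈ M.momentClass j, ∃ s ∈ Icc (-(max Y 1)) (max Y 1), ∃ t ∈ Icc (-(max Y 1)) (max Y 1),
    f = fun z => s * h z + t}

/-- The squares of the functions in `affineClass`. -/
def squareClass (Y : ℝ) (j : Fin dY) : Set (Obs dX dW → ℝ) :=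
  {f | ∃ h ∈ M.affineClass Y j, f = fun z => h z ^ 2}

/-- The instruments are almost surely nonnegative. -/
def InstrNonneg : Prop :=
  ∀ P ∈ M.laws, ∀ g ∈ M.𝒢, ∀ j, ∀ᵐ z ∂(P : Measure (Obs dX dW)), 0 ≤ g z.1 j

/-- Polynomial uniform `L₁` covering numbers, uniformly over all probability measures `Q`. -/
def CoveringBound (Y : ℝ) : Prop :=
  ∃ A > (0 : ℝ), ∃ V > (0 : ℝ), ∀ j, ∀ F ∈ ({M.affineClass Y j, M.squareClass Y j} : Set _),
    ∀ ε : ℝ, 0 < ε → ε < 1 →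
      (⨆ Q : ProbabilityMeasure (Obs dX dW),
        ((coveringNumber ε F (Q : Measure (Obs dX dW)) : ℕ∞) : ℝ≥0∞)) ≤
          ENNReal.ofReal (A * ε ^ (-V))

/-- The moments are almost surely bounded by the constant `Y`. -/
def BoundedMoments (Y : ℝ) : Prop :=
  ∀ P ∈ M.laws, ∀ θ ∈ M.Θ, ∀ g ∈ M.𝒢, ∀ j,
    ∀ᵐ z ∂(P : Measure (Obs dX dW)), |M.moment θ g j z| ≤ Y

/-- The usual measurability condition on the classes of moments. -/
def MeasurableClasses : Prop :=
  ∀ P ∈ M.laws, ∀ j, IsPMeasurableClass (M.momentClass j) (P : Measure (Obs dX dW))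

/-- Parameters bounded away from the identified set violate some moment inequality by an amount
that is bounded away from zero uniformly in `P`. -/
def UniformlyDetectable : Prop :=
  ∀ ε > (0 : ℝ), ∃ δ > (0 : ℝ), ∀ P ∈ M.laws, ∀ θ ∈ M.Θ,
    ENNReal.ofReal ε < Metric.infEDist θ (M.identifiedSet P) →
      ∃ g ∈ M.𝒢, ∃ j, M.mu P θ g j < -δ

/-- `mbar` is differentiable in `θ ∈ Θ` with derivative `Dmbar`, which is continuous in `θ`
uniformly in `(θ, x, P)`. -/
def UniformlyDifferentiable
    (mbar : ProbabilityMeasure (Obs dX dW) → Vec d → Vec dX → Fin dY → ℝ)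
    (Dmbar : ProbabilityMeasure (Obs dX dW) → Vec d → Vec dX → Fin dY → (Vec d →L[ℝ] ℝ)) :
    Prop :=
  (∀ P ∈ M.laws, ∀ x ∈ suppX P, ∀ j, ∀ θ ∈ M.Θ,
    HasFDerivWithinAt (fun θ' => mbar P θ' x j) (Dmbar P θ x j) M.Θ θ) ∧
  ∀ ε > (0 : ℝ), ∃ δ > (0 : ℝ), ∀ P ∈ M.laws, ∀ x ∈ suppX P, ∀ j, ∀ θ ∈ M.Θ, ∀ θ' ∈ M.Θ,
    ‖θ - θ'‖ < δ → ‖Dmbar P θ x j - Dmbar P θ' x j‖ < ε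

/-- To every `P ∈ laws` and `θ ∈ Θ \ Θ₀(P)` one can assign an index `j₀`, a point `θ₀ ∈ Θ₀(P)` and a
contact point `x₀` in the support of `X_i` such that moving from `θ₀` to `θ` decreases the
`j₀`-th conditional mean at a rate bounded away from zero for `x` near `x₀`, and the conditional
mean at `θ₀` grows at most like `‖x - x₀‖^α`. The assignment is local: as `θ` approaches `Θ₀(P)`,
uniformly in `P`, the point `θ₀` approaches `θ` and the segment between them stays in `Θ`. -/
def ContactPoints (α : ℝ)
    (mbar : ProbabilityMeasure (Obs dX dW) → Vec d → Vec dX → Fin dY → ℝ)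
    (Dmbar : ProbabilityMeasure (Obs dX dW) → Vec d → Vec dX → Fin dY → (Vec d →L[ℝ] ℝ)) :
    Prop :=
  ∃ η > (0 : ℝ), ∃ C > (0 : ℝ),
  ∃ (j₀ : Vec d → ProbabilityMeasure (Obs dX dW) → Fin dY)
    (θ₀ : Vec d → ProbabilityMeasure (Obs dX dW) → Vec d)
    (x₀ : Vec d → ProbabilityMeasure (Obs dX dW) → Vec dX),
    (∀ P ∈ M.laws, ∀ θ ∈ M.Θ \ M.identifiedSet P,
      θ₀ θ P ∈ M.identifiedSet P ∧ x₀ θ P ∈ suppX P ∧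
      (∀ x ∈ suppX P, ‖x - x₀ θ P‖ < η →
        Dmbar P (θ₀ θ P) x (j₀ θ P) (θ - θ₀ θ P) ≤ -η * ‖θ - θ₀ θ P‖) ∧
      mbar P (θ₀ θ P) (x₀ θ P) (j₀ θ P) = 0 ∧
      (∀ x ∈ suppX P, ‖x - x₀ θ P‖ < η →
        |mbar P (θ₀ θ P) x (j₀ θ P) - mbar P (θ₀ θ P) (x₀ θ P) (j₀ θ P)|
          ≤ C * ‖x - x₀ θ P‖ ^ α)) ∧
    ∀ ε > (0 : ℝ), ∃ δ > (0 : ℝ), ∀ P ∈ M.laws, ∀ θ ∈ M.Θ \ M.identifiedSet P,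
      Metric.infEDist θ (M.identifiedSet P) < ENNReal.ofReal δ →
        ‖θ - θ₀ θ P‖ < ε ∧ segment ℝ (θ₀ θ P) θ ⊆ M.Θ

/-- Small balls around points of the support of `X_i` have probability at least of the order of
their volume, uniformly in `P`. -/
def SupportMass : Prop :=
  ∃ η > (0 : ℝ), ∀ P ∈ M.laws, ∀ ε : ℝ, 0 < ε → ε ≤ 1 → ∀ x ∈ suppX P,
    ENNReal.ofReal (η * ε ^ dX) ≤ (P : Measure (Obs dX dW)) {z | ‖z.1 - x‖ ≤ ε}

/-- The instruments are uniformly bounded, and for every ball there is an instrument that behaves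
like its indicator. -/
def RichInstr : Prop :=
  (∃ K : ℝ, ∀ g ∈ M.𝒢, ∀ x j, |g x j| ≤ K) ∧
  ∃ C₁ : ℝ, 0 < C₁ ∧ C₁ < 1 ∧ ∃ C₂ : ℝ, 0 < C₂ ∧ C₂ < 1 ∧
    ∀ (s : Vec dX) (t : ℝ), 0 ≤ t → ∃ g ∈ M.𝒢, ∀ P ∈ M.laws,
      ∀ᵐ z ∂(P : Measure (Obs dX dW)), ∀ j,
        C₁ * {x : Vec dX | ‖x - s‖ < C₂ * t}.indicator 1 z.1 ≤ g z.1 j ∧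
        g z.1 j ≤ {x : Vec dX | ‖x - s‖ < t}.indicator 1 z.1

/-- The data dependent critical values `c n` tend to infinity in probability, uniformly in `P`. -/
def TendsToInfty (c : (n : ℕ) → (Fin n → Obs dX dW) → ℝ) : Prop :=
  ∀ K : ℝ, Tendsto (fun n => ⨆ P ∈ M.laws, sampleLaw n P {z | c n z < K}) atTop (𝓝 0)

/-- `c n / √n` tends to zero in probability, uniformly in `P`. -/
def NegligibleToSqrt (c : (n : ℕ) → (Fin n → Obs dX dW) → ℝ) : Prop :=
  ∀ η > (0 : ℝ),
    Tendsto (fun n => ⨆ P ∈ M.laws, sampleLaw n P {z | η < |c n z / √(n : ℝ)|}) atTop (𝓝 0)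

end Model

/-- Conditions on the function `S` that aggregates the moments: `S t` is positive iff some `t_j` is
negative, and it is comparable to the size of the largest negative entry of `t`. -/
def AdmissibleS {dY : ℕ} (S : (Fin dY → ℝ) → ℝ≥0) : Prop :=
  (∀ t, 0 < S t ↔ ∃ j, t j < 0) ∧
  ∃ K₁ > (0 : ℝ), ∃ K₂ > (0 : ℝ), ∀ c : ℝ, 0 < c → ∀ t,
    (c ≤ S t → ∃ j, t j ≤ -(c * K₁)) ∧ ((S t : ℝ) ≤ c → ∀ j, -(c * K₂) ≤ t j)

end CondMoment

end

noncomputable section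

namespace CondMoment

/-! Everything reduces to the event that all deviations `√n |muHat - mu|` are at most `δ ĉ_n`. The
moment classes are bounded with polynomial covering numbers, so symmetrization and chaining
(`measure_empiricalProcess_le`) bound the supremum of these deviations in probability at a fixed
scale, uniformly in `P`. As `ĉ_n → ∞`, the event has probability tending to one
(`tendsto_iSup_sampleLaw`); the rest is deterministic.

On the event, a point of the identified set has nonnegative population moments, so its weighted
sample moments are too close to nonnegative for `S` to exceed `ĉ_n/√n`. This is (a), and it makes
one half of the Hausdorff distance vanish. Conversely, a point `θ` of the estimate satisfies `mu ≥
-L ĉ_n/√n` for every instrument (`neg_le_mu_of_mem_setEstimate`), and uniform detectability puts it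
near the identified set. There let `R = ‖θ - θ₀‖`. The conditional mean at `θ` is at most `-ηR/2 +
C‖x - x₀‖^α`, hence at most `-ηR/4` on a ball of radius of order `R^(1/α)`. That ball has mass of
order at least `R^(dX/α)`, so its instrument has moment at most `-κ R^(1 + dX/α)`
(`exists_mu_le_of_near`). Comparing the two bounds gives `R` of order at most `(ĉ_n/√n)^(α/(dX +
α))`, which is the rate. -/

/-! ### Rademacher averages -/

/-- The sign encoded by a Boolean. -/
def sgn (b : Bool) : ℝ := if b then 1 else -1

lemma sgn_true : sgn true = 1 := rfl

lemma sgn_false : sgn false = -1 := rfl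

lemma abs_sgn (b : Bool) : |sgn b| = 1 := by cases b <;> simp [sgn]

/-- The Rademacher sum `∑ σ_i t_i`. -/
def radSum {ι : Type*} [Fintype ι] (σ : ι → Bool) (t : ι → ℝ) : ℝ := ∑ i, sgn (σ i) * t i

section Rademacher

variable {ι : Type*} [Fintype ι]

lemma radSum_sub (σ : ι → Bool) (s t : ι → ℝ) :
    radSum σ (s - t) = radSum σ s - radSum σ t := by
  simp [radSum, mul_sub, Finset.sum_sub_distrib]

lemma radSum_smul (σ : ι → Bool) (a : ℝ) (t : ι → ℝ) :
    radSum σ (a • t) = a * radSum σ t := by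
  simp [radSum, Finset.mul_sum, mul_left_comm]

lemma abs_radSum_le (σ : ι → Bool) (t : ι → ℝ) : |radSum σ t| ≤ ∑ i, |t i| := by
  refine (Finset.abs_sum_le_sum_abs _ _).trans_eq ?_
  simp [abs_mul, abs_sgn]

/-- The sum over sign vectors factorizes over coordinates into factors `2 cosh (t i)`. Expectations
over signs are kept as unnormalised sums, hence the power of two. -/
lemma sum_exp_radSum_le [DecidableEq ι] (t : ι → ℝ) :
    ∑ σ : ι → Bool, Real.exp (radSum σ t) ≤
      2 ^ Fintype.card ι * Real.exp ((∑ i, t i ^ 2) / 2) := by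
  have h1 : ∑ σ : ι → Bool, Real.exp (radSum σ t) =
      ∏ i, ∑ b : Bool, Real.exp (sgn b * t i) := by
    rw [Finset.prod_univ_sum, Fintype.piFinset_univ]
    exact Finset.sum_congr rfl fun σ _ => by rw [radSum, Real.exp_sum]
  have h2 : ∀ i, ∑ b : Bool, Real.exp (sgn b * t i) ≤ 2 * Real.exp (t i ^ 2 / 2) := by
    intro i
    have := Real.cosh_le_exp_half_sq (t i)
    rw [Real.cosh_eq] at this
    simp only [Fintype.sum_bool, sgn_true, sgn_false, one_mul, neg_mul]
    linarith
  calc _ = ∏ i, ∑ b : Bool, Real.exp (sgn b * t i) := h1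
    _ ≤ ∏ i, (2 * Real.exp (t i ^ 2 / 2)) :=
      Finset.prod_le_prod (fun i _ => Finset.sum_nonneg fun b _ => (Real.exp_pos _).le)
        fun i _ => h2 i
    _ = _ := by
      rw [Finset.prod_mul_distrib, Finset.prod_const, ← Real.exp_sum, Finset.sum_div]
      rfl

/-- An explicit function of the signs dominating the Rademacher sums over a finite family. -/
def radBound {κ : Type*} (N : Finset κ) (v : κ → ι → ℝ) (l a : ℝ) (σ : ι → Bool) : ℝ :=
  l⁻¹ * (a + ∑ k ∈ N, Real.exp (-a) *
    (Real.exp (radSum σ (l • v k)) + Real.exp (radSum σ (-l • v k))))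

/-- The inequality `y ≤ a + exp (-a) * exp y` at `y = l |radSum|` replaces the logarithm of a sum of
exponentials. The resulting bound is linear in the exponentials, so it can be summed over the signs
without Jensen's inequality. -/
lemma abs_radSum_le_radBound {κ : Type*} (N : Finset κ) (v : κ → ι → ℝ) {l : ℝ} (hl : 0 < l)
    (a : ℝ) (σ : ι → Bool) {k : κ} (hk : k ∈ N) :
    |radSum σ (v k)| ≤ radBound N v l a σ := by
  have h1 : l * |radSum σ (v k)| ≤ a + Real.exp (-a) *
      (Real.exp (radSum σ (l • v k)) + Real.exp (radSum σ (-l • v k))) := by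
    have h2 : Real.exp (l * |radSum σ (v k)|) ≤
        Real.exp (radSum σ (l • v k)) + Real.exp (radSum σ (-l • v k)) := by
      rw [radSum_smul, radSum_smul]
      rcases abs_cases (radSum σ (v k)) with ⟨h, _⟩ | ⟨h, _⟩ <;> rw [h]
      · linarith [Real.exp_pos (-l * radSum σ (v k))]
      · rw [mul_neg, ← neg_mul]
        linarith [Real.exp_pos (l * radSum σ (v k))]
    have h3 := Real.add_one_le_exp (-a + l * |radSum σ (v k)|)
    rw [Real.exp_add] at h3
    have h4 := mul_le_mul_of_nonneg_left h2 (Real.exp_pos (-a)).le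
    linarith
  have h5 : Real.exp (-a) *
      (Real.exp (radSum σ (l • v k)) + Real.exp (radSum σ (-l • v k))) ≤ ∑ k ∈ N, Real.exp (-a) *
      (Real.exp (radSum σ (l • v k)) + Real.exp (radSum σ (-l • v k))) :=
    Finset.single_le_sum (f := fun k => Real.exp (-a) *
      (Real.exp (radSum σ (l • v k)) + Real.exp (radSum σ (-l • v k))))
      (fun i _ => by positivity) hk
  rw [radBound, inv_mul_eq_div, le_div_iff₀ hl]
  linarith

/-- Taking `a` at least the log-cardinality makes the weight `exp (-a)` cancel the number of terms;
only `a`, the entropy, survives. -/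
lemma sum_radBound_le [DecidableEq ι] {κ : Type*} (N : Finset κ) (v : κ → ι → ℝ) {l : ℝ}
    (hl : 0 < l) {a D : ℝ} (hN : (N.card : ℝ) ≤ Real.exp a)
    (hD : ∀ k ∈ N, l ^ 2 * ∑ i, v k i ^ 2 ≤ D) :
    ∑ σ : ι → Bool, radBound N v l a σ ≤
      2 ^ Fintype.card ι * (l⁻¹ * (a + 2 * Real.exp (D / 2))) := by
  have hcard : ∑ _σ : ι → Bool, a = 2 ^ Fintype.card ι * a := by simp
  have key : ∀ k ∈ N, ∀ s : ℝ, s ^ 2 = l ^ 2 → ∑ σ : ι → Bool, Real.exp (radSum σ (s • v k)) ≤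
      2 ^ Fintype.card ι * Real.exp (D / 2) := by
    intro k hk s hs
    refine (sum_exp_radSum_le _).trans ?_
    gcongr
    refine le_trans (le_of_eq ?_) (hD k hk)
    simp [mul_pow, hs, Finset.mul_sum]
  simp only [radBound]
  rw [← Finset.mul_sum, Finset.sum_add_distrib, hcard, Finset.sum_comm, mul_left_comm]
  gcongr
  rw [mul_add]
  gcongr
  calc _ ≤ ∑ _k ∈ N, Real.exp (-a) * (2 * (2 ^ Fintype.card ι * Real.exp (D / 2))) := by
        refine Finset.sum_le_sum fun k hk => ?_
        rw [← Finset.mul_sum, Finset.sum_add_distrib]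
        gcongr
        have h1 := key k hk l rfl
        have h2 := key k hk (-l) (by ring)
        linarith
    _ = (N.card * Real.exp (-a)) * (2 * (2 ^ Fintype.card ι * Real.exp (D / 2))) := by
        simp [mul_assoc]
    _ ≤ 1 * (2 * (2 ^ Fintype.card ι * Real.exp (D / 2))) := by
        gcongr
        rw [Real.exp_neg, ← div_eq_mul_inv, div_le_one (Real.exp_pos a)]
        exact hN
    _ = _ := by ring

end Rademacher

/-! ### Chaining -/

lemma sum_geometric_affine (p q : ℝ) (K : ℕ) :
    ∑ k ∈ Finset.range K, (p + q * (k + 1)) / 2 ^ (k + 1) =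
      p + 2 * q - (p + q * (K + 2)) / 2 ^ K := by
  induction K with
  | zero => simp; ring
  | succ K ih =>
    rw [Finset.sum_range_succ, ih]
    push_cast
    field_simp
    ring

/-- The constant of the chaining bound. -/
def chainConst (b r a₀ a₁ : ℝ) : ℝ :=
  (2 * a₀ + 2 * Real.exp (10 * b * r / 2)) + 2 * (2 * a₁) + r

lemma chainConst_nonneg {b r a₀ a₁ : ℝ} (hr : 0 ≤ r) (ha₀ : 0 ≤ a₀) (ha₁ : 0 ≤ a₁) :
    0 ≤ chainConst b r a₀ a₁ := by
  unfold chainConst; positivity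

/-- Chaining bound for the Rademacher averages of a bounded set of vectors with polynomial
covering numbers with respect to the normalised `ℓ¹`-distance. -/
lemma sum_iSup_radSum_le {n : ℕ} (hn : 0 < n) {T : Set (Fin n → ℝ)} {b r a₀ a₁ : ℝ}
    (hb : 0 ≤ b) (hr : 0 ≤ r) (ha₀ : 0 ≤ a₀) (ha₁ : 0 ≤ a₁) (N : ℕ → Finset (Fin n → ℝ))
    (hN0 : ∀ t ∈ N 0, t = 0)
    (hNb : ∀ k, ∀ t ∈ N k, ∀ i, |t i| ≤ b)
    (hNc : ∀ k : ℕ, ((N k).card : ℝ) ≤ Real.exp (a₀ + a₁ * k))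
    (hNd : ∀ k, ∀ t ∈ T, ∃ s ∈ N k, ∑ i, |t i - s i| ≤ n * (r / 4 ^ k)) :
    ∑ σ : Fin n → Bool, ⨆ t ∈ T, ENNReal.ofReal |radSum σ t| ≤
      2 ^ n * ENNReal.ofReal (chainConst b r a₀ a₁ * √n) := by
  classical
  have hn' : (0 : ℝ) < n := by exact_mod_cast hn
  have hsn : 0 < √(n : ℝ) := Real.sqrt_pos.2 hn'
  -- `D` is `lk k ^ 2 = 4^(k+1)/n` times a bound on the squared `ℓ²`-norm of a link, namely `2b`
  -- (sup-norm) times `n * 5r/4^(k+1)` (`ℓ¹`-norm).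
  set D : ℝ := 10 * b * r with hD
  -- Links of the chain: consecutive net points at distances `r/4^(k+1)` and `r/4^k` from a common
  -- `t`, whence the `5r`.
  let Lk : ℕ → Finset ((Fin n → ℝ) × (Fin n → ℝ)) := fun k =>
    (N (k + 1) ×ˢ N k).filter (fun p => ∑ i, |p.1 i - p.2 i| ≤ n * (5 * r / 4 ^ (k + 1)))
  -- For bounded vectors, radius `4^(-k)` in `ℓ¹` means order `2^(-k)` in `ℓ²`; this scaling makes
  -- the exponents bounded in `k`. The entropy `ak` covers pairs of net points.
  let lk : ℕ → ℝ := fun k => 2 ^ (k + 1) / √n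
  let ak : ℕ → ℝ := fun k => 2 * a₀ + (2 * a₁) * (k + 1)
  let v : ((Fin n → ℝ) × (Fin n → ℝ)) → Fin n → ℝ := fun p => p.1 - p.2
  let U : (Fin n → Bool) → ℝ := fun σ => ∑ k ∈ Finset.range n, radBound (Lk k) v (lk k) (ak k) σ
  have hlk : ∀ k, 0 < lk k := fun k => by positivity
  have hak : ∀ k, 0 ≤ ak k := fun k => by positivity
  have hU0 : ∀ σ, 0 ≤ U σ := fun σ => Finset.sum_nonneg fun k _ => by
    have := hak k; have := hlk k; unfold radBound; positivity
  have hpt : ∀ σ, ∀ t ∈ T, |radSum σ t| ≤ U σ + n * (r / 4 ^ n) := by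
    intro σ t ht
    choose s hs hst using fun k => hNd k t ht
    have h0 : radSum σ (s 0) = 0 := by rw [hN0 _ (hs 0)]; simp [radSum]
    -- The chain stops at depth `n`, where even the trivial bound leaves a remainder `n * r/4^n ≤ √n
    -- * r`.
    have h1 : radSum σ t = ∑ k ∈ Finset.range n, radSum σ (v (s (k + 1), s k)) +
        radSum σ (t - s n) := by
      simp only [v, radSum_sub]
      rw [Finset.sum_range_sub (fun k => radSum σ (s k)), h0]
      ring
    rw [h1]
    refine (abs_add_le _ _).trans (add_le_add ((Finset.abs_sum_le_sum_abs _ _).trans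
      (Finset.sum_le_sum fun k _ => ?_)) ((abs_radSum_le _ _).trans (hst n)))
    refine abs_radSum_le_radBound (Lk k) v (hlk k) (ak k) σ ?_
    simp only [Lk, Finset.mem_filter, Finset.mem_product]
    refine ⟨⟨hs _, hs _⟩, ?_⟩
    calc ∑ i, |s (k + 1) i - s k i|
        ≤ ∑ i, (|t i - s (k + 1) i| + |t i - s k i|) := Finset.sum_le_sum fun i _ => by
          rw [abs_sub_comm (t i) (s (k + 1) i)]
          exact abs_sub_le _ _ _
      _ ≤ n * (r / 4 ^ (k + 1)) + n * (r / 4 ^ k) := by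
          rw [Finset.sum_add_distrib]; exact add_le_add (hst _) (hst _)
      _ = _ := by rw [pow_succ]; field_simp; ring
  have hsum : ∑ σ, U σ ≤ 2 ^ n * (√n * ((2 * a₀ + 2 * Real.exp (D / 2)) + 2 * (2 * a₁))) := by
    simp only [U]
    rw [Finset.sum_comm]
    have : ∀ k ∈ Finset.range n, ∑ σ, radBound (Lk k) v (lk k) (ak k) σ ≤
        2 ^ n * (√n * (((2 * a₀ + 2 * Real.exp (D / 2)) + (2 * a₁) * (k + 1)) / 2 ^ (k + 1))) := by
      intro k _
      have := sum_radBound_le (Lk k) v (hlk k) (a := ak k) (D := D) ?_ ?_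
      · rw [Fintype.card_fin] at this
        refine this.trans (le_of_eq ?_)
        simp only [lk, ak, inv_div]
        ring
      · calc ((Lk k).card : ℝ) ≤ ((N (k + 1)).card : ℝ) * (N k).card := by
              rw [← Nat.cast_mul, ← Finset.card_product]
              exact_mod_cast Finset.card_filter_le _ _
          _ ≤ Real.exp (a₀ + a₁ * (k + 1 : ℕ)) * Real.exp (a₀ + a₁ * k) := by
              gcongr
              · exact hNc _
              · exact hNc _
          _ ≤ _ := by
              rw [← Real.exp_add]
              refine Real.exp_le_exp.2 ?_
              simp only [ak]
              push_cast
              linarith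
      · intro p hp
        simp only [Lk, Finset.mem_filter, Finset.mem_product] at hp
        calc lk k ^ 2 * ∑ i, v p i ^ 2 ≤ lk k ^ 2 * ∑ i, 2 * b * |p.1 i - p.2 i| := by
              gcongr with i
              simp only [v, Pi.sub_apply]
              rw [← sq_abs, sq]
              gcongr
              refine (abs_sub _ _).trans ?_
              linarith [hNb _ _ hp.1.1 i, hNb _ _ hp.1.2 i]
          _ ≤ lk k ^ 2 * (2 * b * (n * (5 * r / 4 ^ (k + 1)))) := by
              rw [← Finset.mul_sum]
              gcongr
              exact hp.2
          _ = D := by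
              simp only [lk, div_pow, Real.sq_sqrt hn'.le]
              rw [← pow_mul, mul_comm _ 2, pow_mul]
              norm_num
              field_simp
              rw [hD]; ring
    refine (Finset.sum_le_sum this).trans ?_
    rw [← Finset.mul_sum, ← Finset.mul_sum, sum_geometric_affine]
    gcongr
    rw [sub_le_self_iff]
    positivity
  have hrem : (n : ℝ) * (r / 4 ^ n) ≤ √n * r := by
    have h4 : (n : ℝ) ≤ 4 ^ n := by
      have : n < 4 ^ n := Nat.lt_pow_self (by norm_num)
      exact_mod_cast this.le
    have h5 : (1 : ℝ) ≤ √n := Real.one_le_sqrt.2 (by exact_mod_cast hn)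
    rw [mul_div_assoc', div_le_iff₀ (by positivity)]
    calc (n : ℝ) * r ≤ 4 ^ n * r := by gcongr
      _ ≤ √n * (4 ^ n * r) := le_mul_of_one_le_left (by positivity) h5
      _ = _ := by ring
  calc ∑ σ : Fin n → Bool, ⨆ t ∈ T, ENNReal.ofReal |radSum σ t|
      ≤ ∑ σ : Fin n → Bool, ENNReal.ofReal (U σ + n * (r / 4 ^ n)) :=
        Finset.sum_le_sum fun σ _ => iSup₂_le fun t ht => ENNReal.ofReal_le_ofReal (hpt σ t ht)
    _ = ENNReal.ofReal (∑ σ, (U σ + n * (r / 4 ^ n))) :=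
        (ENNReal.ofReal_sum_of_nonneg fun σ _ => add_nonneg (hU0 σ) (by positivity)).symm
    _ ≤ ENNReal.ofReal (2 ^ n * (chainConst b r a₀ a₁ * √n)) := by
        refine ENNReal.ofReal_le_ofReal ?_
        rw [Finset.sum_add_distrib]
        simp only [Finset.sum_const, Finset.card_univ, Fintype.card_fun, Fintype.card_bool,
          Fintype.card_fin, nsmul_eq_mul, Nat.cast_pow, Nat.cast_ofNat]
        have := mul_le_mul_of_nonneg_left hrem (show (0 : ℝ) ≤ 2 ^ n by positivity)
        unfold chainConst
        rw [← hD]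
        linarith
    _ = _ := by
        rw [ENNReal.ofReal_mul (by positivity), ENNReal.ofReal_pow (by norm_num)]
        norm_num

/-! ### Covering numbers of the values at finitely many points -/

section Covering

variable {Z : Type*} [MeasurableSpace Z]

lemma exists_finset_of_coveringNumber_le {ε x : ℝ} {F : Set (Z → ℝ)} {Q : Measure Z}
    (hx : 0 ≤ x) (h : ((coveringNumber ε F Q : ℕ∞) : ℝ≥0∞) ≤ ENNReal.ofReal x) :
    ∃ C : Finset (Z → ℝ), (C.card : ℝ) ≤ x ∧
      ∀ f ∈ F, ∃ c ∈ C, eLpNorm (f - c) 1 Q ≤ ENNReal.ofReal ε := by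
  have hne : coveringNumber ε F Q ≠ ⊤ := by
    intro h'
    rw [h'] at h
    simp at h
  have hlt : coveringNumber ε F Q < coveringNumber ε F Q + 1 :=
    ENat.lt_add_one_iff hne |>.2 le_rfl
  conv_lhs at hlt => unfold coveringNumber
  simp only [iInf_lt_iff] at hlt
  obtain ⟨C, ⟨-, hC⟩, hlt⟩ := hlt
  have hle : C.encard ≤ coveringNumber ε F Q := ENat.lt_add_one_iff hne |>.1 hlt
  have hfin : C.Finite := Set.encard_ne_top_iff.1 (ne_top_of_le_ne_top hne hle)
  refine ⟨hfin.toFinset, ?_, fun f hf => ?_⟩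
  · have h1 : ((C.encard : ℕ∞) : ℝ≥0∞) ≤ ENNReal.ofReal x :=
      (ENat.toENNReal_le.2 hle).trans h
    rw [hfin.encard_eq_coe_toFinset_card, ENat.toENNReal_coe] at h1
    rw [← ENNReal.ofReal_natCast] at h1
    exact (ENNReal.ofReal_le_ofReal_iff hx).1 h1
  · obtain ⟨c, hc, h⟩ := hC f hf
    exact ⟨c, hfin.mem_toFinset.2 hc, h⟩

/-- The empirical measure of a nonempty finite sample. -/
def empirical {n : ℕ} (hn : 0 < n) (z : Fin n → Z) : ProbabilityMeasure Z :=
  ⟨(n : ℝ≥0∞)⁻¹ • ∑ i, Measure.dirac (z i), ⟨by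
    simp only [Measure.smul_apply, Measure.finsetSum_apply, measure_univ, smul_eq_mul,
      Finset.sum_const, Finset.card_univ, Fintype.card_fin, nsmul_eq_mul, mul_one]
    exact ENNReal.inv_mul_cancel (by exact_mod_cast hn.ne') (ENNReal.natCast_ne_top n)⟩⟩

lemma eLpNorm_empirical [MeasurableSingletonClass Z] {n : ℕ} (hn : 0 < n) (z : Fin n → Z)
    (f : Z → ℝ) :
    eLpNorm f 1 (empirical hn z : Measure Z) = ENNReal.ofReal ((n : ℝ)⁻¹ * ∑ i, |f (z i)|) := by
  have hn' : (0 : ℝ) < n := by exact_mod_cast hn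
  rw [eLpNorm_one_eq_lintegral_enorm]
  simp only [empirical, ProbabilityMeasure.coe_mk, lintegral_smul_measure,
    lintegral_finsetSum_measure, lintegral_dirac, smul_eq_mul]
  rw [ENNReal.ofReal_mul (by positivity), ENNReal.ofReal_inv_of_pos hn', ENNReal.ofReal_natCast,
    ENNReal.ofReal_sum_of_nonneg (fun i _ => abs_nonneg _)]
  simp [Real.enorm_eq_ofReal_abs]

/-- Polynomial bound for the uniform `L₁` covering numbers of one class. -/
def PolyCover (A V : ℝ) (F : Set (Z → ℝ)) : Prop :=
  ∀ ε : ℝ, 0 < ε → ε < 1 →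
    (⨆ Q : ProbabilityMeasure Z, ((coveringNumber ε F (Q : Measure Z) : ℕ∞) : ℝ≥0∞)) ≤
      ENNReal.ofReal (A * ε ^ (-V))

lemma coveringNumber_mono {ε : ℝ} {F G : Set (Z → ℝ)} (h : F ⊆ G) (Q : Measure Z) :
    coveringNumber ε F Q ≤ coveringNumber ε G Q :=
  le_iInf₂ fun C hC => iInf₂_le C ⟨hC.1, fun f hf => hC.2 f (h hf)⟩

lemma PolyCover.mono {A V : ℝ} {F G : Set (Z → ℝ)} (hG : PolyCover A V G) (h : F ⊆ G) :
    PolyCover A V F := fun ε h0 h1 =>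
  (iSup_mono fun _ => ENat.toENNReal_le.2 (coveringNumber_mono h _)).trans (hG ε h0 h1)

variable [MeasurableSingletonClass Z]

/-- At the empirical measure, `L₁(Q)` is the normalised `ℓ¹`-distance of the vectors of sampled
values. -/
lemma PolyCover.exists_finset {A V : ℝ} (hA : 0 ≤ A) {F : Set (Z → ℝ)} (hF : PolyCover A V F)
    {ε : ℝ} (h0 : 0 < ε) (h1 : ε < 1) {n : ℕ} (hn : 0 < n) (z : Fin n → Z) :
    ∃ C : Finset (Fin n → ℝ), (C.card : ℝ) ≤ A * ε ^ (-V) ∧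
      ∀ f ∈ F, ∃ s ∈ C, ∑ i, |f (z i) - s i| ≤ n * ε := by
  classical
  have hn' : (0 : ℝ) < n := by exact_mod_cast hn
  obtain ⟨C, hC, h⟩ := exists_finset_of_coveringNumber_le (Q := (empirical hn z : Measure Z))
    (by positivity) ((le_iSup (fun Q : ProbabilityMeasure Z =>
      ((coveringNumber ε F (Q : Measure Z) : ℕ∞) : ℝ≥0∞)) (empirical hn z)).trans (hF ε h0 h1))
  refine ⟨C.image fun c => c ∘ z, le_trans (by exact_mod_cast Finset.card_image_le) hC,
    fun f hf => ?_⟩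
  obtain ⟨c, hc, hfc⟩ := h f hf
  refine ⟨c ∘ z, Finset.mem_image_of_mem _ hc, ?_⟩
  rw [eLpNorm_empirical, ENNReal.ofReal_le_ofReal_iff h0.le, inv_mul_le_iff₀ hn'] at hfc
  exact hfc

/-- Centers outside the class may be unbounded, whereas chaining needs bounded net points. Each
useful center is replaced by a class member near it, which doubles the radius. -/
lemma PolyCover.exists_finset_subset {A V : ℝ} (hA : 0 ≤ A) {F : Set (Z → ℝ)}
    (hF : PolyCover A V F) {ε : ℝ} (h0 : 0 < ε) (h1 : ε < 1) {n : ℕ} (hn : 0 < n)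
    (z : Fin n → Z) :
    ∃ C : Finset (Fin n → ℝ), (C.card : ℝ) ≤ A * ε ^ (-V) ∧
      (∀ s ∈ C, ∃ f ∈ F, s = f ∘ z) ∧
      ∀ f ∈ F, ∃ s ∈ C, ∑ i, |f (z i) - s i| ≤ n * (2 * ε) := by
  classical
  obtain ⟨C, hC, h⟩ := hF.exists_finset hA h0 h1 hn z
  let p : (Fin n → ℝ) → Prop := fun s => ∃ f ∈ F, ∑ i, |f (z i) - s i| ≤ n * ε
  let rep : (Fin n → ℝ) → (Fin n → ℝ) := fun s => if hs : p s then hs.choose ∘ z else 0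
  refine ⟨(C.filter p).image rep, ?_, ?_, ?_⟩
  · refine le_trans ?_ hC
    exact_mod_cast Finset.card_image_le.trans (Finset.card_filter_le _ _)
  · intro t ht
    obtain ⟨s, hs, rfl⟩ := Finset.mem_image.1 ht
    have hp := (Finset.mem_filter.1 hs).2
    exact ⟨hp.choose, hp.choose_spec.1, by simp only [rep, dif_pos hp]⟩
  · intro f hf
    obtain ⟨s, hs, hfs⟩ := h f hf
    have hp : p s := ⟨f, hf, hfs⟩
    refine ⟨rep s, Finset.mem_image_of_mem _ (Finset.mem_filter.2 ⟨hs, hp⟩), ?_⟩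
    simp only [rep, dif_pos hp, Function.comp_apply]
    calc ∑ i, |f (z i) - hp.choose (z i)|
        ≤ ∑ i, (|f (z i) - s i| + |hp.choose (z i) - s i|) := Finset.sum_le_sum fun i _ => by
          rw [abs_sub_comm (hp.choose (z i))]
          exact abs_sub_le _ _ _
      _ ≤ n * ε + n * ε := by
          rw [Finset.sum_add_distrib]
          exact add_le_add hfs hp.choose_spec.2
      _ = _ := by ring

/-- Polynomial covering numbers of the multiples `s f`, `s ∈ [0, 1]`, force `f` to be bounded. -/
lemma PolyCover.abs_le {A V : ℝ} (hA : 0 ≤ A) {F : Set (Z → ℝ)} (hF : PolyCover A V F)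
    {f : Z → ℝ} (hf : ∀ s ∈ Icc (0 : ℝ) 1, (fun z => s * f z) ∈ F) (z : Z) :
    |f z| ≤ A * (1 / 2 : ℝ) ^ (-V) := by
  classical
  -- A sample of size one gives the point mass at `z`, so the covering bound controls the value at
  -- every point.
  obtain ⟨C, hC, h⟩ := hF.exists_finset hA (ε := 1 / 2) (by norm_num) (by norm_num)
    Nat.one_pos (fun _ => z)
  refine le_trans ?_ hC
  by_contra! hlt
  set N := C.card with hN
  have hNpos : 0 < N := by
    obtain ⟨s, hs, -⟩ := h _ (hf 0 (by simp))
    exact Finset.card_pos.2 ⟨s, hs⟩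
  have hNr : (0 : ℝ) < N := by exact_mod_cast hNpos
  have hmem : ∀ k ∈ Finset.range (N + 1), (k / N : ℝ) ∈ Icc (0 : ℝ) 1 := by
    intro k hk
    refine ⟨by positivity, (div_le_one hNr).2 ?_⟩
    exact_mod_cast Nat.lt_succ_iff.1 (Finset.mem_range.1 hk)
  let c : ℕ → (Fin 1 → ℝ) := fun k =>
    if hk : k ∈ Finset.range (N + 1) then (h _ (hf _ (hmem k hk))).choose else 0
  have hc : ∀ k ∈ Finset.range (N + 1), c k ∈ C ∧ |(k / N : ℝ) * f z - c k 0| ≤ 1 / 2 := by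
    intro k hk
    have := (h _ (hf _ (hmem k hk))).choose_spec
    simp only [c, dif_pos hk]
    refine ⟨this.1, ?_⟩
    simpa using this.2
  -- Two of the `N + 1` values `(k/N) f(z)` share a center, so they differ by at most `1`; hence `|f
  -- z| ≤ N`.
  obtain ⟨k, hk, l, hl, hkl, hckl⟩ := Finset.exists_ne_map_eq_of_card_lt_of_maps_to
    (s := Finset.range (N + 1)) (t := C) (f := c) (by simp [hN]) (fun k hk => (hc k hk).1)
  have h1 := (hc k hk).2
  have h2 := (hc l hl).2
  rw [hckl] at h1
  have h3 : |(k / N : ℝ) * f z - (l / N : ℝ) * f z| ≤ 1 := by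
    refine (abs_sub_le _ (c l 0) _).trans ?_
    rw [abs_sub_comm (c l 0)]
    linarith
  have h4 : (1 : ℝ) ≤ |(k : ℝ) - l| := by
    have : (k : ℤ) - l ≠ 0 := sub_ne_zero.2 (by exact_mod_cast hkl)
    exact_mod_cast Int.one_le_abs this
  rw [← sub_mul, ← sub_div, abs_mul, abs_div, abs_of_pos hNr, div_mul_eq_mul_div,
    div_le_one hNr] at h3
  have h5 := mul_le_mul_of_nonneg_right h4 (abs_nonneg (f z))
  linarith

/-- The constant of the uniform bound for Rademacher averages. -/
def radConst (A V b : ℝ) : ℝ :=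
  chainConst b (max 2 b) (Real.log (max A 1)) (V * Real.log 4)

lemma radConst_nonneg {A V b : ℝ} (hV : 0 ≤ V) : 0 ≤ radConst A V b :=
  chainConst_nonneg (le_max_of_le_left (by norm_num)) (Real.log_nonneg (le_max_right _ _))
    (mul_nonneg hV (Real.log_nonneg (by norm_num)))

lemma PolyCover.sum_iSup_radSum_le {A V b : ℝ} (hA : 0 ≤ A) (hV : 0 ≤ V) (hb : 0 ≤ b)
    {F : Set (Z → ℝ)} (hF : PolyCover A V F) (hFb : ∀ f ∈ F, ∀ z, |f z| ≤ b) {n : ℕ}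
    (hn : 0 < n) (z : Fin n → Z) :
    ∑ σ : Fin n → Bool, ⨆ f ∈ F, ENNReal.ofReal |radSum σ (f ∘ z)| ≤
      2 ^ n * ENNReal.ofReal (radConst A V b * √n) := by
  classical
  have hn' : (0 : ℝ) < n := by exact_mod_cast hn
  -- `r ≥ b` lets `{0}` serve as the net at level `0`; `r ≥ 2` absorbs the doubled radius of nets
  -- inside the class.
  set r := max 2 b with hr
  have hr0 : 0 ≤ r := le_max_of_le_left (by norm_num)
  have hε : ∀ k : ℕ, (1 / 4 ^ (k + 1) : ℝ) < 1 := fun k => by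
    rw [div_lt_one (by positivity)]
    exact one_lt_pow₀ (by norm_num) (by simp)
  choose C hCc hCF hCd using fun k : ℕ =>
    hF.exists_finset_subset hA (ε := 1 / 4 ^ (k + 1)) (by positivity) (hε k) hn z
  let N : ℕ → Finset (Fin n → ℝ) := fun k => Nat.casesOn k {0} C
  have key := CondMoment.sum_iSup_radSum_le hn (T := (fun f => f ∘ z) '' F) (b := b) (r := r)
    (a₀ := Real.log (max A 1)) (a₁ := V * Real.log 4) hb hr0
    (Real.log_nonneg (le_max_right _ _)) (mul_nonneg hV (Real.log_nonneg (by norm_num))) N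
    ?_ ?_ ?_ ?_
  · rw [radConst, ← hr]
    simpa only [iSup_image] using key
  · intro t ht
    simpa [N] using ht
  · intro k t ht i
    cases k with
    | zero =>
      have : t = 0 := by simpa [N] using ht
      simpa [this] using hb
    | succ k =>
      obtain ⟨f, hf, rfl⟩ := hCF k t ht
      exact hFb f hf _
  · intro k
    cases k with
    | zero =>
      rw [show (N 0).card = 1 from rfl, Nat.cast_one]
      exact Real.one_le_exp (by simpa using Real.log_nonneg (le_max_right A 1))
    | succ k =>
      refine (hCc k).trans ?_
      rw [Real.exp_add, Real.exp_log (by positivity)]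
      refine mul_le_mul (le_max_left _ _) (le_of_eq ?_) (by positivity) (by positivity)
      rw [Real.rpow_def_of_pos (by positivity)]
      congr 1
      rw [one_div, Real.log_inv, Real.log_pow]
      ring
  · rintro k _ ⟨f, hf, rfl⟩
    cases k with
    | zero =>
      refine ⟨0, by simp [N], ?_⟩
      calc ∑ i, |(f ∘ z) i - (0 : Fin n → ℝ) i| ≤ ∑ _i : Fin n, r :=
            Finset.sum_le_sum fun i _ => by
              simpa only [Function.comp_apply, Pi.zero_apply, sub_zero] using
                (hFb f hf (z i)).trans (le_max_right 2 b)
        _ = _ := by simp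
    | succ k =>
      obtain ⟨s, hs, h⟩ := hCd k f hf
      refine ⟨s, hs, h.trans ?_⟩
      gcongr
      rw [mul_one_div]
      gcongr
      exact le_max_left _ _

end Covering

/-! ### Symmetrization -/

section Symmetrization

variable {Z : Type*}

/-- The supremum over a class of the absolute value of a linear combination of values. -/
def supAbs {ι : Type*} [Fintype ι] (F : Set (Z → ℝ)) (e : ι → ℝ) (z : ι → Z) : ℝ≥0∞ :=
  ⨆ f ∈ F, ENNReal.ofReal |∑ i, e i * f (z i)|

lemma supAbs_comp_equiv {ι κ : Type*} [Fintype ι] [Fintype κ] (F : Set (Z → ℝ)) (φ : ι ≃ κ)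
    (e : κ → ℝ) (z : κ → Z) : supAbs F (e ∘ φ) (z ∘ φ) = supAbs F e z := by
  unfold supAbs
  congr! 5 with f hf
  exact φ.sum_comp fun i => e i * f (z i)

lemma supAbs_sumElim_le {ι κ : Type*} [Fintype ι] [Fintype κ] (F : Set (Z → ℝ))
    (e : ι → ℝ) (e' : κ → ℝ) (z : ι ⊕ κ → Z) :
    supAbs F (Sum.elim e e') z ≤ supAbs F e (z ∘ Sum.inl) + supAbs F e' (z ∘ Sum.inr) := by
  refine iSup₂_le fun f hf => ?_
  rw [Fintype.sum_sum_type]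
  refine (ENNReal.ofReal_le_ofReal (abs_add_le _ _)).trans ?_
  rw [ENNReal.ofReal_add (abs_nonneg _) (abs_nonneg _)]
  exact add_le_add (le_iSup₂_of_le f hf le_rfl) (le_iSup₂_of_le f hf le_rfl)

lemma supAbs_neg {ι : Type*} [Fintype ι] (F : Set (Z → ℝ)) (e : ι → ℝ) (z : ι → Z) :
    supAbs F (-e) z = supAbs F e z := by
  simp [supAbs]

variable [MeasurableSpace Z] (P : Measure Z) [IsProbabilityMeasure P]

lemma measurePreserving_comp_equiv {ι κ : Type*} [Fintype ι] [Fintype κ] (φ : ι ≃ κ) :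
    MeasurePreserving (fun z : κ → Z => z ∘ φ) (Measure.pi fun _ => P) (Measure.pi fun _ => P) :=
  (measurePreserving_piCongrLeft (fun _ : κ => P) φ).symm

lemma measurePreserving_comp_inl {ι κ : Type*} [Fintype ι] [Fintype κ] :
    MeasurePreserving (fun z : ι ⊕ κ → Z => z ∘ Sum.inl) (Measure.pi fun _ => P)
      (Measure.pi fun _ => P) :=
  measurePreserving_fst.comp (measurePreserving_sumPiEquivProdPi (fun _ : ι ⊕ κ => P))

lemma measurePreserving_comp_inr {ι κ : Type*} [Fintype ι] [Fintype κ] :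
    MeasurePreserving (fun z : ι ⊕ κ → Z => z ∘ Sum.inr) (Measure.pi fun _ => P)
      (Measure.pi fun _ => P) :=
  measurePreserving_snd.comp (measurePreserving_sumPiEquivProdPi (fun _ : ι ⊕ κ => P))

lemma lintegral_comp_of_measurePreserving {α β : Type*} [MeasurableSpace α] [MeasurableSpace β]
    {μ : Measure α} {ν : Measure β} {T : α → β} (hT : MeasurePreserving T μ ν) {h : β → ℝ≥0∞}
    (hh : AEMeasurable h ν) : ∫⁻ x, h (T x) ∂μ = ∫⁻ y, h y ∂ν := by
  rw [← hT.map_eq, lintegral_map' (by rwa [hT.map_eq]) hT.aemeasurable]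

variable {P} {F : Set (Z → ℝ)}

lemma IsPMeasurableClass.aemeasurable_supAbs (hF : IsPMeasurableClass F P) {ι : Type*}
    [Fintype ι] (e : ι → ℝ) : AEMeasurable (supAbs F e) (Measure.pi fun _ => P) := by
  have φ := Fintype.equivFin ι
  have h := (hF (Fintype.card ι) (e ∘ φ.symm)).comp_quasiMeasurePreserving
    (measurePreserving_comp_equiv P φ.symm).quasiMeasurePreserving
  refine h.congr (ae_of_all _ fun z => ?_)
  exact supAbs_comp_equiv F φ.symm e z

/-- Exchangeability of an iid sample. -/
lemma IsPMeasurableClass.lintegral_supAbs_comp (hF : IsPMeasurableClass F P) {ι : Type*}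
    [Fintype ι] (e : ι → ℝ) (φ : ι ≃ ι) :
    ∫⁻ z, supAbs F (e ∘ φ) z ∂(Measure.pi fun _ => P) =
      ∫⁻ z, supAbs F e z ∂(Measure.pi fun _ => P) := by
  rw [← lintegral_comp_of_measurePreserving (measurePreserving_comp_equiv P φ)
    (hF.aemeasurable_supAbs (e ∘ φ))]
  simp only [supAbs_comp_equiv]

/-- Exchange of the two copies of those indices at which `σ` is false. -/
def swapAt {ι : Type*} (σ : ι → Bool) : ι ⊕ ι ≃ ι ⊕ ι :=
  Function.Involutive.toPerm
    (Sum.elim (fun i => if σ i then Sum.inl i else Sum.inr i)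
      (fun i => if σ i then Sum.inr i else Sum.inl i)) (by
    rintro (i | i) <;> by_cases h : σ i <;> simp [h])

lemma sumElim_one_comp_swapAt {ι : Type*} (σ : ι → Bool) :
    (Sum.elim 1 (-1) : ι ⊕ ι → ℝ) ∘ swapAt σ =
      Sum.elim (fun i => sgn (σ i)) (-fun i => sgn (σ i)) := by
  ext (i | i) <;> by_cases h : σ i <;>
    simp [swapAt, Function.Involutive.toPerm, h, sgn]

/-- Swapping paired observations preserves the law of the doubled sample and turns the coefficients
`±1` into arbitrary signs; the two halves then contribute equally. -/
lemma IsPMeasurableClass.lintegral_supAbs_sumElim_le (hF : IsPMeasurableClass F P) {ι : Type*}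
    [Fintype ι] (σ : ι → Bool) :
    ∫⁻ z, supAbs F (Sum.elim 1 (-1) : ι ⊕ ι → ℝ) z ∂(Measure.pi fun _ => P) ≤
      2 * ∫⁻ z, supAbs F (fun i => sgn (σ i)) z ∂(Measure.pi fun _ => P) := by
  rw [← hF.lintegral_supAbs_comp _ (swapAt σ), sumElim_one_comp_swapAt]
  set s : ι → ℝ := fun i => sgn (σ i)
  refine (lintegral_mono fun z => supAbs_sumElim_le F s (-s) z).trans ?_
  have hm := hF.aemeasurable_supAbs s
  have hm' : AEMeasurable (fun z : ι ⊕ ι → Z => supAbs F s (z ∘ Sum.inl))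
      (Measure.pi fun _ => P) :=
    hm.comp_quasiMeasurePreserving (measurePreserving_comp_inl P).quasiMeasurePreserving
  rw [lintegral_add_left' hm']
  simp only [supAbs_neg]
  rw [lintegral_comp_of_measurePreserving (measurePreserving_comp_inl P) hm,
    lintegral_comp_of_measurePreserving (measurePreserving_comp_inr P) hm, two_mul]

/-- The bound by signed suprema holds for each sign vector, hence for their average; the chaining
bound then applies pointwise in the sample. -/
lemma lintegral_supAbs_two_sample_le [MeasurableSingletonClass Z] {A V b : ℝ} (hA : 0 ≤ A)
    (hV : 0 ≤ V) (hb : 0 ≤ b) (hF : PolyCover A V F) (hFb : ∀ f ∈ F, ∀ z, |f z| ≤ b)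
    (hFm : IsPMeasurableClass F P) {n : ℕ} (hn : 0 < n) :
    ∫⁻ z, supAbs F (Sum.elim 1 (-1) : Fin n ⊕ Fin n → ℝ) z ∂(Measure.pi fun _ => P) ≤
      2 * ENNReal.ofReal (radConst A V b * √n) := by
  have h1 : (2 : ℝ≥0∞) ^ n *
      ∫⁻ z, supAbs F (Sum.elim 1 (-1) : Fin n ⊕ Fin n → ℝ) z ∂(Measure.pi fun _ => P) ≤
      2 ^ n * (2 * ENNReal.ofReal (radConst A V b * √n)) := by
    calc _ = ∑ _σ : Fin n → Bool,
          ∫⁻ z, supAbs F (Sum.elim 1 (-1) : Fin n ⊕ Fin n → ℝ) z ∂(Measure.pi fun _ => P) := by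
          simp
      _ ≤ ∑ σ : Fin n → Bool, 2 * ∫⁻ z, supAbs F (fun i => sgn (σ i)) z
            ∂(Measure.pi fun _ => P) :=
          Finset.sum_le_sum fun σ _ => hFm.lintegral_supAbs_sumElim_le σ
      _ = 2 * ∫⁻ z, ∑ σ : Fin n → Bool, supAbs F (fun i => sgn (σ i)) z
            ∂(Measure.pi fun _ => P) := by
          rw [← Finset.mul_sum, lintegral_finsetSum' _ fun σ _ => hFm.aemeasurable_supAbs _]
      _ ≤ 2 * ∫⁻ _z, 2 ^ n * ENNReal.ofReal (radConst A V b * √n)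
            ∂(Measure.pi fun _ : Fin n => P) := by
          gcongr with z
          exact hF.sum_iSup_radSum_le hA hV hb hFb hn z
      _ = _ := by
          simp only [lintegral_const, measure_univ, mul_one]
          ring
  exact (ENNReal.mul_le_mul_iff_right (by positivity) (by simp)).1 h1

/-- The expectation is an average over an independent ghost sample, and the absolute value moves
inside the integral. -/
lemma ofReal_abs_sum_sub_le (hFm : ∀ f ∈ F, Integrable f P) {n : ℕ}
    (z : Fin n → Z) {f : Z → ℝ} (hf : f ∈ F) :
    ENNReal.ofReal |∑ i, f (z i) - n * ∫ x, f x ∂P| ≤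
      ∫⁻ z', supAbs F (Sum.elim 1 (-1) : Fin n ⊕ Fin n → ℝ) (Sum.elim z z')
        ∂(Measure.pi fun _ => P) := by
  have hmp : ∀ i : Fin n, MeasurePreserving (Function.eval i) (Measure.pi fun _ : Fin n => P) P :=
    fun i => measurePreserving_eval (fun _ : Fin n => P) i
  have hint : ∀ i : Fin n, Integrable (fun z' : Fin n → Z => f (z' i))
      (Measure.pi fun _ : Fin n => P) := fun i =>
    (hmp i).integrable_comp_of_integrable (hFm f hf)
  have hval : ∀ i : Fin n, ∫ z' : Fin n → Z, f (z' i) ∂(Measure.pi fun _ : Fin n => P) =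
      ∫ x, f x ∂P := fun i => by
    have h := (hmp i).map_eq
    conv_rhs => rw [← h]
    rw [integral_map (hmp i).aemeasurable (by rw [h]; exact (hFm f hf).1)]
  have heq : ∑ i, f (z i) - n * ∫ x, f x ∂P =
      ∫ z' : Fin n → Z, (∑ i, f (z i) - ∑ i, f (z' i)) ∂(Measure.pi fun _ : Fin n => P) := by
    rw [integral_sub (integrable_const _) (integrable_finsetSum _ fun i _ => hint i),
      integral_finsetSum _ fun i _ => hint i]
    simp [hval]
  rw [heq, ← Real.enorm_eq_ofReal_abs]
  refine (enorm_integral_le_lintegral_enorm _).trans (lintegral_mono fun z' => ?_)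
  rw [Real.enorm_eq_ofReal_abs]
  refine le_iSup₂_of_le f hf (le_of_eq ?_)
  congr 2
  simp [Fintype.sum_sum_type, sub_eq_add_neg]

/-- Maximal inequality: the empirical process indexed by a uniformly bounded class with
polynomial covering numbers is stochastically bounded, with constants that depend only on the
covering numbers and the bound. -/
theorem measure_empiricalProcess_le [MeasurableSingletonClass Z] {A V b : ℝ} (hA : 0 ≤ A)
    (hV : 0 ≤ V) (hb : 0 ≤ b) (hF : PolyCover A V F) (hFb : ∀ f ∈ F, ∀ z, |f z| ≤ b)
    (hFmeas : ∀ f ∈ F, Measurable f)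
    (hFm : IsPMeasurableClass F P) {n : ℕ} (hn : 0 < n) {K : ℝ} (hK : 0 < K) :
    (Measure.pi fun _ : Fin n => P)
      {z | ∃ f ∈ F, K < √n * |(n : ℝ)⁻¹ * ∑ i, f (z i) - ∫ x, f x ∂P|} ≤
      ENNReal.ofReal (2 * radConst A V b / K) := by
  have hn' : (0 : ℝ) < n := by exact_mod_cast hn
  have hsn : 0 < √(n : ℝ) := Real.sqrt_pos.2 hn'
  have hint : ∀ f ∈ F, Integrable f P := fun f hf =>
    Integrable.of_bound (hFmeas f hf).aestronglyMeasurable b (ae_of_all _ (hFb f hf))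
  let G : (Fin n → Z) × (Fin n → Z) → ℝ≥0∞ := fun p =>
    supAbs F (Sum.elim 1 (-1) : Fin n ⊕ Fin n → ℝ) (Sum.elim p.1 p.2)
  -- The deviation event need not be measurable. It lies in a superlevel set of `H`, which is a.e.
  -- measurable by Fubini, so Markov's inequality applies to `H`.
  let H : (Fin n → Z) → ℝ≥0∞ := fun z => ∫⁻ z', G (z, z') ∂(Measure.pi fun _ => P)
  have hmp : MeasurePreserving
      (fun p : (Fin n → Z) × (Fin n → Z) => (Sum.elim p.1 p.2 : Fin n ⊕ Fin n → Z))
      ((Measure.pi fun _ => P).prod (Measure.pi fun _ => P)) (Measure.pi fun _ => P) := by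
    convert measurePreserving_sumPiEquivProdPi_symm (fun _ : Fin n ⊕ Fin n => P) using 1
    ext p (i | i) <;> rfl
  have hsup := hFm.aemeasurable_supAbs (Sum.elim 1 (-1) : Fin n ⊕ Fin n → ℝ)
  have hG : AEMeasurable G ((Measure.pi fun _ => P).prod (Measure.pi fun _ => P)) :=
    hsup.comp_quasiMeasurePreserving hmp.quasiMeasurePreserving
  have hH : AEMeasurable H (Measure.pi fun _ => P) := hG.lintegral_prod_right'
  have hHint : ∫⁻ z, H z ∂(Measure.pi fun _ => P) ≤
      2 * ENNReal.ofReal (radConst A V b * √n) := by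
    rw [← lintegral_prod G hG, lintegral_comp_of_measurePreserving hmp hsup]
    exact lintegral_supAbs_two_sample_le hA hV hb hF hFb hFm hn
  have hsub : {z : Fin n → Z | ∃ f ∈ F, K < √n * |(n : ℝ)⁻¹ * ∑ i, f (z i) - ∫ x, f x ∂P|} ⊆
      {z | ENNReal.ofReal (K * √n) ≤ H z} := by
    rintro z ⟨f, hf, hlt⟩
    refine le_trans (ENNReal.ofReal_le_ofReal ?_) (ofReal_abs_sum_sub_le hint z hf)
    have h1 : ∑ i, f (z i) - n * ∫ x, f x ∂P =
        n * ((n : ℝ)⁻¹ * ∑ i, f (z i) - ∫ x, f x ∂P) := by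
      field_simp
    rw [h1, abs_mul, abs_of_pos hn']
    calc K * √n ≤ (√n * |(n : ℝ)⁻¹ * ∑ i, f (z i) - ∫ x, f x ∂P|) * √n := by gcongr
      _ = (√n * √n) * |(n : ℝ)⁻¹ * ∑ i, f (z i) - ∫ x, f x ∂P| := by ring
      _ = _ := by rw [Real.mul_self_sqrt hn'.le]
  refine (measure_mono hsub).trans ?_
  have hpos : 0 < K * √n := by positivity
  refine (meas_ge_le_lintegral_div hH (by simpa using hpos) ENNReal.ofReal_ne_top).trans ?_
  rw [ENNReal.div_le_iff (by simpa using hpos) ENNReal.ofReal_ne_top]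
  refine hHint.trans (le_of_eq ?_)
  have hC : 0 ≤ radConst A V b := radConst_nonneg hV
  rw [← ENNReal.ofReal_mul (by positivity), show (2 : ℝ≥0∞) = ENNReal.ofReal 2 by simp,
    ← ENNReal.ofReal_mul (by norm_num)]
  congr 1
  field_simp

end Symmetrization

namespace Model

variable {dX dW dY d : ℕ} {M : Model dX dW dY d}

/-! ### The empirical moments -/

lemma measurable_m_left {θ : Vec d} (hθ : θ ∈ M.Θ) (j : Fin dY) :
    Measurable fun z : Obs dX dW => M.m z.2 θ j :=
  (measurable_pi_apply j).comp (M.measurable_m.comp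
    (measurable_snd.prodMk (measurable_const (a := (⟨θ, hθ⟩ : M.Θ)))))

lemma measurable_instr {g : Instr dX dY} (hg : g ∈ M.𝒢) (j : Fin dY) :
    Measurable fun x => g x j :=
  (measurable_pi_apply j).comp (M.measurable_𝒢 g hg)

lemma measurable_moment {θ : Vec d} (hθ : θ ∈ M.Θ) {g : Instr dX dY} (hg : g ∈ M.𝒢)
    (j : Fin dY) : Measurable (M.moment θ g j) :=
  (measurable_m_left hθ j).mul ((measurable_instr hg j).comp measurable_fst)

lemma mul_mem_affineClass {Y : ℝ} {j : Fin dY} {f : Obs dX dW → ℝ} (hf : f ∈ M.momentClass j)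
    {s : ℝ} (hs : s ∈ Icc (0 : ℝ) 1) : (fun z => s * f z) ∈ M.affineClass Y j := by
  have h1 : (1 : ℝ) ≤ max Y 1 := le_max_right _ _
  exact ⟨f, hf, s, ⟨by linarith [hs.1], hs.2.trans h1⟩, 0, ⟨by linarith, by linarith⟩, by simp⟩

/-- The affine class contains the multiples `s f`, `s ∈ [0, 1]`, so `PolyCover.abs_le` gives a bound
at every point, not only almost surely. -/
lemma CoveringBound.exists_polyCover {Y : ℝ} (h : M.CoveringBound Y) :
    ∃ A V b : ℝ, 0 ≤ A ∧ 0 ≤ V ∧ 0 ≤ b ∧ ∀ j, PolyCover A V (M.momentClass j) ∧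
      ∀ f ∈ M.momentClass j, ∀ z, |f z| ≤ b := by
  obtain ⟨A, hA, V, hV, h⟩ := h
  refine ⟨A, V, A * (1 / 2 : ℝ) ^ (-V), hA.le, hV.le, by positivity, fun j => ?_⟩
  have hc : PolyCover A V (M.affineClass Y j) := h j _ (by simp)
  refine ⟨hc.mono fun f hf => ?_, fun f hf z =>
    hc.abs_le hA.le (fun s hs => mul_mem_affineClass hf hs) z⟩
  simpa using mul_mem_affineClass (Y := Y) hf (s := 1) (by simp)

/-- The rescaled deviation of some empirical moment exceeds `K`. -/
def deviationSet (M : Model dX dW dY d) (P : ProbabilityMeasure (Obs dX dW)) (n : ℕ) (K : ℝ) :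
    Set (Fin n → Obs dX dW) :=
  {z | ∃ θ ∈ M.Θ, ∃ g ∈ M.𝒢, ∃ j, K < √n * |M.muHat z θ g j - M.mu P θ g j|}

/-- The empirical moments are `√n`-consistent, uniformly in the law, the parameter and the
instrument. -/
lemma exists_measure_deviationSet_le (hmeas : M.MeasurableClasses) {Y : ℝ}
    (hcov : M.CoveringBound Y) :
    ∃ C : ℝ, ∀ P ∈ M.laws, ∀ n : ℕ, 0 < n → ∀ K : ℝ, 0 < K →
      sampleLaw n P (M.deviationSet P n K) ≤ ENNReal.ofReal (C / K) := by
  obtain ⟨A, V, b, hA, hV, hb, h⟩ := hcov.exists_polyCover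
  have hC := radConst_nonneg (A := A) (b := b) hV
  refine ⟨dY * (2 * radConst A V b), fun P hP n hn K hK => ?_⟩
  have hsub : M.deviationSet P n K ⊆ ⋃ j, {z | ∃ f ∈ M.momentClass j,
      K < √n * |(n : ℝ)⁻¹ * ∑ i, f (z i) - ∫ x, f x ∂(P : Measure (Obs dX dW))|} := by
    rintro z ⟨θ, hθ, g, hg, j, hz⟩
    exact mem_iUnion.2 ⟨j, M.moment θ g j, ⟨θ, hθ, g, hg, rfl⟩, hz⟩
  refine (measure_mono hsub).trans ((measure_iUnion_fintype_le _ _).trans ?_)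
  calc _ ≤ ∑ _j : Fin dY, ENNReal.ofReal (2 * radConst A V b / K) := by
        refine Finset.sum_le_sum fun j _ => ?_
        refine measure_empiricalProcess_le hA hV hb (h j).1 (h j).2 ?_ (hmeas P hP j) hn hK
        rintro f ⟨θ, hθ, g, hg, rfl⟩
        exact measurable_moment hθ hg j
    _ = _ := by
        rw [Finset.sum_const, Finset.card_univ, Fintype.card_fin, nsmul_eq_mul, mul_div_assoc (dY : ℝ),
          ENNReal.ofReal_mul (by positivity), ENNReal.ofReal_natCast]

/-! ### The population moments -/

/-- Countably many instruments for growing balls suffice: each is at least `C₁` on its inner ball,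
so dividing the bound `Y` on the product by `C₁` bounds `m`. The radius `(k + 1)/C₂` gives the inner
ball radius `k + 1`. -/
lemma exists_ae_abs_m_le {Y : ℝ} (hbdd : M.BoundedMoments Y) (hrich : M.RichInstr) :
    ∃ L : ℝ, ∀ P ∈ M.laws, ∀ θ ∈ M.Θ, ∀ j,
      ∀ᵐ z ∂(P : Measure (Obs dX dW)), |M.m z.2 θ j| ≤ L := by
  obtain ⟨-, C₁, hC₁, -, C₂, hC₂, -, h⟩ := hrich
  choose g hg hgb using fun k : ℕ => h 0 ((k + 1 : ℝ) / C₂) (by positivity)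
  refine ⟨Y / C₁, fun P hP θ hθ j => ?_⟩
  filter_upwards [ae_all_iff.2 fun k => hgb k P hP,
    ae_all_iff.2 fun k => hbdd P hP θ hθ (g k) (hg k) j] with z hz hzb
  obtain ⟨k, hk⟩ := exists_nat_gt ‖z.1‖
  have h1 := (hz k j).1
  have hmem : z.1 ∈ {x : Vec dX | ‖x - 0‖ < C₂ * ((k + 1 : ℝ) / C₂)} := by
    simp only [mem_ofPred_eq, sub_zero]
    rw [mul_div_cancel₀ _ hC₂.ne']
    linarith
  rw [indicator_of_mem hmem, Pi.one_apply, mul_one] at h1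
  rw [le_div_iff₀ hC₁]
  calc |M.m z.2 θ j| * C₁ ≤ |M.m z.2 θ j| * |g k z.1 j| := by
        gcongr
        exact h1.trans (le_abs_self _)
    _ ≤ Y := by
        rw [← abs_mul]
        exact hzb k

lemma integrable_m {Y : ℝ} (hbdd : M.BoundedMoments Y) (hrich : M.RichInstr)
    {P : ProbabilityMeasure (Obs dX dW)} (hP : P ∈ M.laws) {θ : Vec d} (hθ : θ ∈ M.Θ)
    (j : Fin dY) : Integrable (fun z => M.m z.2 θ j) (P : Measure (Obs dX dW)) := by
  obtain ⟨L, hL⟩ := exists_ae_abs_m_le hbdd hrich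
  exact Integrable.of_bound (measurable_m_left hθ j).aestronglyMeasurable L (hL P hP θ hθ j)

lemma integrable_mul_instr (hrich : M.RichInstr) {P : ProbabilityMeasure (Obs dX dW)}
    {g : Instr dX dY} (hg : g ∈ M.𝒢) (j : Fin dY) {f : Obs dX dW → ℝ}
    (hf : Integrable f (P : Measure (Obs dX dW))) :
    Integrable (fun z => f z * g z.1 j) (P : Measure (Obs dX dW)) := by
  obtain ⟨⟨K, hK⟩, -⟩ := hrich
  exact hf.mul_bdd (c := K) ((measurable_instr hg j).comp measurable_fst).aestronglyMeasurable
    (ae_of_all _ fun z => hK g hg z.1 j)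

/-- An instrument is a function of `X_i` alone, so it pulls out of the conditional expectation. -/
lemma mu_eq_integral_condMoment {Y : ℝ} (hbdd : M.BoundedMoments Y) (hrich : M.RichInstr)
    {P : ProbabilityMeasure (Obs dX dW)} (hP : P ∈ M.laws) {θ : Vec d} (hθ : θ ∈ M.Θ)
    {g : Instr dX dY} (hg : g ∈ M.𝒢) (j : Fin dY) :
    M.mu P θ g j = ∫ z, M.condMoment P θ j z * g z.1 j ∂(P : Measure (Obs dX dW)) := by
  have hm := integrable_m hbdd hrich hP hθ j
  have hle : MeasurableSpace.comap (Prod.fst : Obs dX dW → Vec dX) inferInstance ≤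
      (inferInstance : MeasurableSpace (Obs dX dW)) := measurable_fst.comap_le
  have hgm : StronglyMeasurable[MeasurableSpace.comap (Prod.fst : Obs dX dW → Vec dX)
      inferInstance] fun z : Obs dX dW => g z.1 j :=
    ((measurable_instr hg j).comp (comap_measurable _)).stronglyMeasurable
  have h1 := condExp_mul_of_stronglyMeasurable_right (μ := (P : Measure (Obs dX dW))) hgm
    (integrable_mul_instr hrich hg j hm) hm
  calc M.mu P θ g j = ∫ z, (M.m z.2 θ j) * g z.1 j ∂(P : Measure (Obs dX dW)) := rfl
    _ = _ := by
      rw [← integral_condExp hle]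
      exact integral_congr_ae h1

lemma mu_nonneg {Y : ℝ} (hbdd : M.BoundedMoments Y) (hrich : M.RichInstr) (hnn : M.InstrNonneg)
    {P : ProbabilityMeasure (Obs dX dW)} (hP : P ∈ M.laws) {θ : Vec d}
    (hθ : θ ∈ M.identifiedSet P) {g : Instr dX dY} (hg : g ∈ M.𝒢) (j : Fin dY) :
    0 ≤ M.mu P θ g j := by
  rw [mu_eq_integral_condMoment hbdd hrich hP hθ.1 hg]
  refine integral_nonneg_of_ae ?_
  filter_upwards [hθ.2, hnn P hP g hg j] with z h1 h2 using mul_nonneg (h1 j) h2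

lemma ae_mem_suppX (P : ProbabilityMeasure (Obs dX dW)) :
    ∀ᵐ z ∂(P : Measure (Obs dX dW)), z.1 ∈ suppX P :=
  ae_of_ae_map measurable_fst.aemeasurable Measure.support_mem_ae

/-- If the conditional mean is below `-a` on a ball around a point of the support, then the
instrument for this ball detects the violation. -/
lemma exists_mu_le_of_mbar_le {Y : ℝ} (hbdd : M.BoundedMoments Y) (hrich : M.RichInstr)
    (hnn : M.InstrNonneg) (hsupp : M.SupportMass)
    {mbar : ProbabilityMeasure (Obs dX dW) → Vec d → Vec dX → Fin dY → ℝ}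
    (hmbar : M.IsCondMean mbar) :
    ∃ κ > (0 : ℝ), ∀ P ∈ M.laws, ∀ θ ∈ M.Θ, ∀ j, ∀ x₀ ∈ suppX P, ∀ t a : ℝ, 0 < t → t ≤ 1 →
      0 ≤ a → (∀ x ∈ suppX P, ‖x - x₀‖ < t → mbar P θ x j ≤ -a) →
      ∃ g ∈ M.𝒢, M.mu P θ g j ≤ -(κ * a * t ^ dX) := by
  have hrich' := hrich
  obtain ⟨-, C₁, hC₁, -, C₂, hC₂, hC₂', h⟩ := hrich'
  obtain ⟨η, hη, hmass⟩ := hsupp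
  -- `C₁` is the height of the instrument on the inner ball; the other factor is the mass bound for
  -- the closed ball of radius `C₂ t/2`, which fits in the open inner ball.
  refine ⟨C₁ * (η * (C₂ / 2) ^ dX), by positivity, fun P hP θ hθ j x₀ hx₀ t a ht ht1 ha hneg => ?_⟩
  obtain ⟨g, hg, hgb⟩ := h x₀ t ht.le
  refine ⟨g, hg, ?_⟩
  set E : Set (Vec dX) := {x | ‖x - x₀‖ < C₂ * t} with hE
  have hEm : MeasurableSet E := measurableSet_lt (by fun_prop) measurable_const
  set E' : Set (Obs dX dW) := Prod.fst ⁻¹' E with hE'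
  have hEm' : MeasurableSet E' := measurable_fst hEm
  have hint : Integrable (M.condMoment P θ j) (P : Measure (Obs dX dW)) := integrable_condExp
  have hmass' : η * (C₂ / 2) ^ dX * t ^ dX ≤ (P : Measure (Obs dX dW)).real E' := by
    have hlt : C₂ * t / 2 < C₂ * t := by linarith [mul_pos hC₂ ht]
    have hle1 : C₂ * t / 2 ≤ 1 := by
      have : C₂ * t ≤ 1 * 1 := by gcongr
      linarith
    have h1 := hmass P hP (C₂ * t / 2) (by positivity) hle1 x₀ hx₀
    have h2 : {z : Obs dX dW | ‖z.1 - x₀‖ ≤ C₂ * t / 2} ⊆ E' := fun z hz =>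
      lt_of_le_of_lt (show ‖z.1 - x₀‖ ≤ _ from hz) hlt
    have h3 := h1.trans (measure_mono h2)
    rw [ENNReal.ofReal_le_iff_le_toReal (measure_ne_top _ _)] at h3
    refine le_trans (le_of_eq ?_) h3
    rw [mul_div_right_comm, mul_pow, mul_assoc]
  have hpt : (fun z => M.condMoment P θ j z * g z.1 j) ≤ᵐ[(P : Measure (Obs dX dW))]
      fun z => E'.indicator (fun _ => -(a * C₁)) z := by
    filter_upwards [hmbar P hP θ hθ j, hgb P hP, hnn P hP g hg j, ae_mem_suppX P]
      with z hz1 hz2 hz3 hz4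
    rw [← hz1]
    obtain ⟨hlo, hup⟩ := hz2 j
    by_cases hzt : ‖z.1 - x₀‖ < t
    · have hm := hneg z.1 hz4 hzt
      have h5 : mbar P θ z.1 j * g z.1 j ≤ -a * g z.1 j := by gcongr
      refine h5.trans ?_
      by_cases hzE : z ∈ E'
      · rw [indicator_of_mem (show z.1 ∈ E from hzE), Pi.one_apply, mul_one] at hlo
        rw [indicator_of_mem hzE]
        nlinarith
      · rw [indicator_of_notMem hzE]
        nlinarith
    · rw [indicator_of_notMem (show z.1 ∉ {x : Vec dX | ‖x - x₀‖ < t} from hzt)] at hup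
      have hzE : z ∉ E' := fun hz => hzt (lt_trans (show ‖z.1 - x₀‖ < C₂ * t from hz)
        (by nlinarith))
      rw [indicator_of_notMem hzE, le_antisymm hup hz3, mul_zero]
  rw [mu_eq_integral_condMoment hbdd hrich hP hθ hg]
  refine (integral_mono_ae (integrable_mul_instr hrich hg j hint)
    ((integrable_const _).indicator hEm') hpt).trans ?_
  rw [integral_indicator hEm', setIntegral_const, smul_eq_mul]
  have := mul_le_mul_of_nonneg_right hmass' (mul_nonneg ha hC₁.le)
  linarith

/-- Close to the identified set, the violation of the moment inequalities is of the order of a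
power of an upper bound for the distance. -/
lemma exists_mu_le_of_near {Y : ℝ} (hbdd : M.BoundedMoments Y) (hrich : M.RichInstr)
    (hnn : M.InstrNonneg) (hsupp : M.SupportMass)
    {mbar : ProbabilityMeasure (Obs dX dW) → Vec d → Vec dX → Fin dY → ℝ}
    (hmbar : M.IsCondMean mbar)
    {Dmbar : ProbabilityMeasure (Obs dX dW) → Vec d → Vec dX → Fin dY → (Vec d →L[ℝ] ℝ)}
    (hdiff : M.UniformlyDifferentiable mbar Dmbar) {α : ℝ} (hα : 0 < α)
    (hx₀ : M.ContactPoints α mbar Dmbar) :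
    ∃ δ > (0 : ℝ), ∃ κ > (0 : ℝ), ∀ P ∈ M.laws, ∀ θ ∈ M.Θ \ M.identifiedSet P,
      Metric.infEDist θ (M.identifiedSet P) < ENNReal.ofReal δ →
      ∃ R : ℝ, 0 ≤ R ∧ Metric.infEDist θ (M.identifiedSet P) ≤ ENNReal.ofReal R ∧
        ∃ g ∈ M.𝒢, ∃ j, M.mu P θ g j ≤ -(κ * R ^ (1 + dX / α)) := by
  obtain ⟨κ, hκ, hball⟩ := exists_mu_le_of_mbar_le hbdd hrich hnn hsupp hmbar
  obtain ⟨η, hη, C, hC, j₀, θ₀, x₀, hcontact, hlocal⟩ := hx₀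
  obtain ⟨ε₁, hε₁, hD⟩ := hdiff.2 (η / 2) (by positivity)
  set s : ℝ := min η 1 with hs
  have hs0 : 0 < s := lt_min hη one_pos
  -- With `t ^ α = q * R`, the Hölder term is at most `C * q * R = η/4 * R`.
  set q : ℝ := η / (4 * C) with hq
  have hq0 : 0 < q := by positivity
  -- `ε₁` keeps the derivative along the segment within `η/2` of its value at `θ₀`; the other term
  -- ensures `t ≤ min η 1`.
  set ε : ℝ := min ε₁ (s ^ α / q) with hε
  have hε0 : 0 < ε := lt_min hε₁ (by positivity)
  obtain ⟨δ, hδ, hloc⟩ := hlocal ε hε0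
  refine ⟨δ, hδ, κ * (η / 4) * q ^ (dX / α), by positivity, fun P hP θ hθ hdist => ?_⟩
  obtain ⟨hθ₀, hx₀s, hder, hzero, hhold⟩ := hcontact P hP θ hθ
  obtain ⟨hnear, hseg⟩ := hloc P hP θ hθ hdist
  set R : ℝ := ‖θ - θ₀ θ P‖ with hR
  have hR0 : 0 < R := by
    refine norm_pos_iff.2 (sub_ne_zero.2 fun h => hθ.2 ?_)
    rw [h]
    exact hθ₀
  set t : ℝ := (q * R) ^ α⁻¹ with ht
  have ht0 : 0 < t := by positivity
  have htα : t ^ α = q * R := Real.rpow_inv_rpow (by positivity) hα.ne'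
  have hts : t ≤ s := by
    rw [ht, Real.rpow_inv_le_iff_of_pos (by positivity) hs0.le hα, mul_comm,
      ← le_div_iff₀ hq0]
    exact hnear.le.trans (min_le_right _ _)
  have htη : t ≤ η := hts.trans (min_le_left _ _)
  have ht1 : t ≤ 1 := hts.trans (min_le_right _ _)
  refine ⟨R, hR0.le, ?_, ?_⟩
  · refine (Metric.infEDist_le_edist_of_mem hθ₀).trans_eq ?_
    rw [edist_dist, dist_eq_norm]
  have hneg : ∀ x ∈ suppX P, ‖x - x₀ θ P‖ < t → mbar P θ x (j₀ θ P) ≤ -(η / 4 * R) := by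
    intro x hx hxt
    have hxη : ‖x - x₀ θ P‖ < η := hxt.trans_le htη
    have h1 := hder x hx hxη
    have h2 := hhold x hx hxη
    rw [hzero, sub_zero] at h2
    have h3 : C * ‖x - x₀ θ P‖ ^ α ≤ η / 4 * R := by
      calc C * ‖x - x₀ θ P‖ ^ α ≤ C * t ^ α := by gcongr
        _ = η / 4 * R := by rw [htα, hq]; field_simp
    -- Mean value inequality along the segment. The slopes then add up to `-η + η/2 + η/4 = -η/4`.
    have h4 : ‖mbar P θ x (j₀ θ P) - mbar P (θ₀ θ P) x (j₀ θ P) -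
        Dmbar P (θ₀ θ P) x (j₀ θ P) (θ - θ₀ θ P)‖ ≤ η / 2 * ‖θ - θ₀ θ P‖ := by
      refine (convex_segment (θ₀ θ P) θ).norm_image_sub_le_of_norm_hasFDerivWithin_le'
        (f := fun θ' => mbar P θ' x (j₀ θ P)) (f' := fun θ' => Dmbar P θ' x (j₀ θ P))
        (fun y hy => (hdiff.1 P hP x hx (j₀ θ P) y (hseg hy)).mono hseg) (fun y hy => ?_)
        (left_mem_segment ℝ _ _) (right_mem_segment ℝ _ _)
      refine (hD P hP x hx (j₀ θ P) y (hseg hy) (θ₀ θ P) hθ₀.1 ?_).le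
      have h5 : ‖y - θ₀ θ P‖ ≤ ‖θ - θ₀ θ P‖ := by
        rw [segment_eq_image'] at hy
        obtain ⟨u, hu, rfl⟩ := hy
        rw [add_sub_cancel_left, norm_smul, Real.norm_of_nonneg hu.1]
        exact mul_le_of_le_one_left (norm_nonneg _) hu.2
      exact h5.trans_lt (hnear.trans_le (min_le_left _ _))
    have h6 := (abs_le.1 (Real.norm_eq_abs _ ▸ h4)).2
    have h7 := (abs_le.1 h2).2
    linarith
  obtain ⟨g, hg, hmu⟩ := hball P hP θ hθ.1 (j₀ θ P) (x₀ θ P) hx₀s t (η / 4 * R) ht0 ht1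
    (by positivity) hneg
  refine ⟨g, hg, j₀ θ P, hmu.trans (le_of_eq ?_)⟩
  have h1 : t ^ dX = q ^ (dX / α) * R ^ (dX / α) := by
    rw [← Real.rpow_natCast, ht, ← Real.rpow_mul (by positivity),
      ← Real.mul_rpow hq0.le hR0.le, inv_mul_eq_div]
  rw [h1, Real.rpow_add hR0, Real.rpow_one]
  ring

/-! ### The set estimate on the event of small deviations -/

lemma mem_setEstimate_iff {S : (Fin dY → ℝ) → ℝ≥0} {ω : Vec d → Instr dX dY → Fin dY → ℝ}
    {n : ℕ} (hn : 0 < n) {z : Fin n → Obs dX dW} {c : ℝ} (hc : 0 < c) {θ : Vec d} :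
    θ ∈ M.setEstimate S ω z c ↔
      θ ∈ M.Θ ∧ ∀ g ∈ M.𝒢, (S (fun j => ω θ g j * M.muHat z θ g j) : ℝ) ≤ c / √n := by
  have hsn : 0 < √(n : ℝ) := Real.sqrt_pos.2 (by exact_mod_cast hn)
  have hc' : (c : EReal) = ((ENNReal.ofReal c : ℝ≥0∞) : EReal) := by
    rw [EReal.coe_ennreal_ofReal, max_eq_left hc.le]
  refine and_congr_right fun _ => ?_
  rw [hc', EReal.coe_ennreal_le_coe_ennreal_iff]
  have h1 : ENNReal.ofReal c = ENNReal.ofReal √n * ENNReal.ofReal (c / √n) := by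
    rw [← ENNReal.ofReal_mul hsn.le, mul_div_cancel₀ _ hsn.ne']
  rw [h1, ENNReal.mul_le_mul_iff_right (by simpa using hn) ENNReal.ofReal_ne_top, ksStat,
    iSup₂_le_iff]
  refine forall₂_congr fun g _ => ?_
  rw [← ENNReal.ofReal_coe_nnreal, ENNReal.ofReal_le_ofReal_iff (by positivity)]

lemma abs_muHat_sub_mu_le {P : ProbabilityMeasure (Obs dX dW)} {n : ℕ} (hn : 0 < n) {K : ℝ}
    {z : Fin n → Obs dX dW} (hz : z ∉ M.deviationSet P n K) {θ : Vec d} (hθ : θ ∈ M.Θ)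
    {g : Instr dX dY} (hg : g ∈ M.𝒢) (j : Fin dY) :
    |M.muHat z θ g j - M.mu P θ g j| ≤ K / √n := by
  have hsn : 0 < √(n : ℝ) := Real.sqrt_pos.2 (by exact_mod_cast hn)
  rw [le_div_iff₀ hsn, mul_comm]
  by_contra! h
  exact hz ⟨θ, hθ, g, hg, j, h⟩

/-- Sampling error can push a weighted moment down only to `-W δ c/√n`, short of the `-K₁ c/√n`
required for exclusion. -/
lemma identifiedSet_subset_setEstimate {Y : ℝ} (hbdd : M.BoundedMoments Y)
    (hrich : M.RichInstr) (hnn : M.InstrNonneg) {S : (Fin dY → ℝ) → ℝ≥0} {K₁ W δ : ℝ}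
    (hS : ∀ c : ℝ, 0 < c → ∀ t, c ≤ S t → ∃ j, t j ≤ -(c * K₁)) (hW : W * δ < K₁) (hδ : 0 ≤ δ)
    {ω : Vec d → Instr dX dY → Fin dY → ℝ}
    (hω : ∀ θ ∈ M.Θ, ∀ g ∈ M.𝒢, ∀ j, 0 ≤ ω θ g j ∧ ω θ g j ≤ W)
    {P : ProbabilityMeasure (Obs dX dW)} (hP : P ∈ M.laws) {n : ℕ} (hn : 0 < n)
    {z : Fin n → Obs dX dW} {c : ℝ} (hc : 0 < c) (hz : z ∉ M.deviationSet P n (δ * c)) :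
    M.identifiedSet P ⊆ M.setEstimate S ω z c := by
  intro θ hθ
  have hsn : 0 < √(n : ℝ) := Real.sqrt_pos.2 (by exact_mod_cast hn)
  have hcn : 0 < c / √n := div_pos hc hsn
  refine (mem_setEstimate_iff hn hc).2 ⟨hθ.1, fun g hg => ?_⟩
  by_contra! hlt
  obtain ⟨j, hj⟩ := hS _ hcn _ hlt.le
  have h1 := (abs_le.1 (abs_muHat_sub_mu_le hn hz hθ.1 hg j)).1
  have h2 := mu_nonneg hbdd hrich hnn hP hθ hg j
  obtain ⟨h3, h4⟩ := hω θ hθ.1 g hg j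
  have h5 : -(δ * (c / √n)) ≤ M.muHat z θ g j := by
    rw [mul_div_assoc] at h1
    linarith
  have h6 : ω θ g j * -(δ * (c / √n)) ≤ ω θ g j * M.muHat z θ g j := by gcongr
  have h7 : ω θ g j * (δ * (c / √n)) ≤ W * (δ * (c / √n)) := by gcongr
  have h8 : W * δ * (c / √n) < K₁ * (c / √n) := by gcongr
  linarith

/-- The weighted sample moments are at least `-K₂ c/√n`. Undoing the weight costs `1/w`, since only
negative moments matter, and sampling error adds `δ`. -/
lemma neg_le_mu_of_mem_setEstimate {S : (Fin dY → ℝ) → ℝ≥0} {K₂ w δ : ℝ} (hK₂ : 0 ≤ K₂)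
    (hS : ∀ c : ℝ, 0 < c → ∀ t, (S t : ℝ) ≤ c → ∀ j, -(c * K₂) ≤ t j) (hw : 0 < w)
    {ω : Vec d → Instr dX dY → Fin dY → ℝ}
    (hω : ∀ θ ∈ M.Θ, ∀ g ∈ M.𝒢, ∀ j, w ≤ ω θ g j)
    {P : ProbabilityMeasure (Obs dX dW)} {n : ℕ} (hn : 0 < n)
    {z : Fin n → Obs dX dW} {c : ℝ} (hc : 0 < c) (hz : z ∉ M.deviationSet P n (δ * c))
    {θ : Vec d} (hθ : θ ∈ M.setEstimate S ω z c) {g : Instr dX dY} (hg : g ∈ M.𝒢) (j : Fin dY) :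
    -((K₂ / w + δ) * (c / √n)) ≤ M.mu P θ g j := by
  have hsn : 0 < √(n : ℝ) := Real.sqrt_pos.2 (by exact_mod_cast hn)
  have hcn : 0 < c / √n := div_pos hc hsn
  obtain ⟨hθΘ, hθS⟩ := (mem_setEstimate_iff hn hc).1 hθ
  have h1 := hS _ hcn _ (hθS g hg) j
  have h2 := (abs_le.1 (abs_muHat_sub_mu_le hn hz hθΘ hg j)).2
  rw [mul_div_assoc] at h2
  have h3 : -(K₂ / w * (c / √n)) ≤ M.muHat z θ g j := by
    by_contra! hlt
    have h4 : M.muHat z θ g j ≤ 0 := hlt.le.trans (by rw [neg_nonpos]; positivity)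
    have h5 : ω θ g j * M.muHat z θ g j ≤ w * M.muHat z θ g j :=
      mul_le_mul_of_nonpos_right (hω θ hθΘ g hg j) h4
    have h6 : w * M.muHat z θ g j < w * -(K₂ / w * (c / √n)) := by gcongr
    have h7 : w * -(K₂ / w * (c / √n)) = -(c / √n * K₂) := by field_simp
    linarith
  linarith

/-- On the event of small deviations, points of the set estimate are close to the identified
set. -/
lemma exists_infEDist_le {Y : ℝ} (hbdd : M.BoundedMoments Y) (hrich : M.RichInstr)
    (hnn : M.InstrNonneg) (hcons : M.UniformlyDetectable) (hsupp : M.SupportMass)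
    {mbar : ProbabilityMeasure (Obs dX dW) → Vec d → Vec dX → Fin dY → ℝ}
    (hmbar : M.IsCondMean mbar)
    {Dmbar : ProbabilityMeasure (Obs dX dW) → Vec d → Vec dX → Fin dY → (Vec d →L[ℝ] ℝ)}
    (hdiff : M.UniformlyDifferentiable mbar Dmbar) {α : ℝ} (hα : 0 < α)
    (hx₀ : M.ContactPoints α mbar Dmbar) {L : ℝ} (hL : 0 < L) :
    ∃ B : ℝ, 0 ≤ B ∧ ∃ ρ > (0 : ℝ), ∀ P ∈ M.laws, ∀ θ ∈ M.Θ, ∀ u : ℝ, 0 ≤ u → u ≤ ρ →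
      (∀ g ∈ M.𝒢, ∀ j, -(L * u) ≤ M.mu P θ g j) →
      Metric.infEDist θ (M.identifiedSet P) ≤
        ENNReal.ofReal (B * (u ^ 2) ^ (α / (2 * dX + 2 * α))) := by
  obtain ⟨δ₁, hδ₁, κ, hκ, hnear⟩ :=
    exists_mu_le_of_near hbdd hrich hnn hsupp hmbar hdiff hα hx₀
  -- Failing to exceed `δ₁/2` gives the strict inequality `< δ₁` needed by the local bound.
  obtain ⟨δ₂, hδ₂, hfar⟩ := hcons (δ₁ / 2) (by positivity)
  set k : ℝ := α / (2 * dX + 2 * α) with hk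
  have hden : (0 : ℝ) < 2 * dX + 2 * α := by positivity
  refine ⟨(L / κ) ^ (2 * k), by positivity, δ₂ / L, by positivity,
    fun P hP θ hθ u hu huρ hmu => ?_⟩
  by_cases hmem : θ ∈ M.identifiedSet P
  · rw [Metric.infEDist_zero_of_mem hmem]
    exact zero_le
  have hdist : Metric.infEDist θ (M.identifiedSet P) < ENNReal.ofReal δ₁ := by
    refine lt_of_le_of_lt ?_ ((ENNReal.ofReal_lt_ofReal_iff hδ₁).2 (half_lt_self hδ₁))
    by_contra! hlt
    obtain ⟨g, hg, j, h⟩ := hfar P hP θ hθ hlt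
    have h1 := hmu g hg j
    rw [le_div_iff₀ hL] at huρ
    linarith
  obtain ⟨R, hR, hRdist, g, hg, j, h⟩ := hnear P hP θ ⟨hθ, hmem⟩ hdist
  refine hRdist.trans (ENNReal.ofReal_le_ofReal ?_)
  have h1 : R ^ (1 + dX / α) ≤ L / κ * u := by
    rw [div_mul_eq_mul_div, le_div_iff₀ hκ]
    linarith [hmu g hg j]
  -- `2k = α/(dX + α)` inverts the exponent of the local bound.
  have hexp : (1 + dX / α) * (2 * k) = 1 := by
    rw [hk]
    have : (dX : ℝ) + α ≠ 0 := by positivity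
    field_simp
    ring
  calc R = (R ^ (1 + dX / α)) ^ (2 * k) := by rw [← Real.rpow_mul hR, hexp, Real.rpow_one]
    _ ≤ (L / κ * u) ^ (2 * k) := by gcongr
    _ = (L / κ) ^ (2 * k) * (u ^ 2) ^ k := by
      rw [Real.mul_rpow (by positivity) hu, Real.rpow_mul hu, Real.rpow_two]

lemma rate_mul_le {n : ℕ} (hn : 0 < n) {c : ℝ} (hc : 0 < c) (k B : ℝ) :
    ((n : ℝ≥0∞) / ENNReal.ofReal (c ^ 2)) ^ k *
      ENNReal.ofReal (B * ((c / √n) ^ 2) ^ k) = ENNReal.ofReal B := by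
  have hn' : (0 : ℝ) < n := by exact_mod_cast hn
  rw [← ENNReal.ofReal_natCast, ← ENNReal.ofReal_div_of_pos (by positivity),
    ENNReal.ofReal_rpow_of_pos (by positivity), ← ENNReal.ofReal_mul (by positivity)]
  congr 1
  rw [mul_left_comm, ← Real.mul_rpow (by positivity) (by positivity), div_pow,
    Real.sq_sqrt hn'.le, div_mul_div_cancel₀ (by positivity), div_self hn'.ne', Real.one_rpow,
    mul_one]

/-! ### Uniform convergence in probability -/

/-- Events that, up to large values of `c n / √n`, force deviations of the order of `c n` have
vanishing outer probability, uniformly in the law. -/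
lemma tendsto_iSup_sampleLaw (hmeas : M.MeasurableClasses) {Y : ℝ} (hcov : M.CoveringBound Y)
    {c : (n : ℕ) → (Fin n → Obs dX dW) → ℝ} (hc : M.TendsToInfty c)
    (hc' : M.NegligibleToSqrt c) {δ ρ : ℝ} (hδ : 0 < δ) (hρ : 0 < ρ)
    (E : (n : ℕ) → ProbabilityMeasure (Obs dX dW) → Set (Fin n → Obs dX dW))
    (hE : ∀ P ∈ M.laws, ∀ n : ℕ, 0 < n → ∀ z ∈ E n P, 0 < c n z → c n z / √n ≤ ρ →
      z ∈ M.deviationSet P n (δ * c n z)) :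
    Tendsto (fun n => ⨆ P ∈ M.laws, sampleLaw n P (E n P)) atTop (𝓝 0) := by
  obtain ⟨C, hC⟩ := exists_measure_deviationSet_le hmeas hcov
  rw [ENNReal.tendsto_nhds_zero]
  intro ε hε
  have hε3 : 0 < ε / 3 := ENNReal.div_pos hε.ne' (by norm_num)
  have hlim : Tendsto (fun K : ℝ => ENNReal.ofReal (C / (δ * K))) atTop (𝓝 0) := by
    have : Tendsto (fun K : ℝ => C / (δ * K)) atTop (𝓝 0) :=
      tendsto_const_nhds.div_atTop (tendsto_id.const_mul_atTop hδ)
    simpa using ENNReal.tendsto_ofReal this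
  obtain ⟨K, hK, hK0⟩ :=
    (((ENNReal.tendsto_nhds_zero.1 hlim) _ hε3).and (eventually_gt_atTop 0)).exists
  filter_upwards [(ENNReal.tendsto_nhds_zero.1 (hc K)) _ hε3,
    (ENNReal.tendsto_nhds_zero.1 (hc' ρ hρ)) _ hε3, eventually_gt_atTop 0] with n h1 h2 hn
  refine iSup₂_le fun P hP => ?_
  have hsn : 0 < √(n : ℝ) := Real.sqrt_pos.2 (by exact_mod_cast hn)
  -- The random threshold `δ * c n z` is replaced by the fixed `δ * K`, since the maximal inequality
  -- needs a deterministic level.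
  have hsub : E n P ⊆ ({z | c n z < K} ∪ {z | ρ < |c n z / √(n : ℝ)|}) ∪
      M.deviationSet P n (δ * K) := by
    intro z hz
    by_cases hzK : c n z < K
    · exact Or.inl (Or.inl hzK)
    by_cases hzρ : ρ < |c n z / √(n : ℝ)|
    · exact Or.inl (Or.inr hzρ)
    push Not at hzK hzρ
    obtain ⟨θ, hθ, g, hg, j, h⟩ := hE P hP n hn z hz (hK0.trans_le hzK)
      ((le_abs_self _).trans hzρ)
    exact Or.inr ⟨θ, hθ, g, hg, j, lt_of_le_of_lt (by gcongr) h⟩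
  calc sampleLaw n P (E n P) ≤ ε / 3 + ε / 3 + ε / 3 := by
        refine (measure_mono hsub).trans ((measure_union_le _ _).trans
          (add_le_add ((measure_union_le _ _).trans (add_le_add ?_ ?_)) ?_))
        · exact (le_iSup₂ (f := fun P (_ : P ∈ M.laws) =>
            sampleLaw n P {z | c n z < K}) P hP).trans h1
        · exact (le_iSup₂ (f := fun P (_ : P ∈ M.laws) =>
            sampleLaw n P {z | ρ < |c n z / √(n : ℝ)|}) P hP).trans h2
        · exact (hC P hP n hn _ (by positivity)).trans hK
    _ = ε := ENNReal.add_thirds ε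

/-- Nonemptiness of the class of laws gives the upper bound: an infimum over no laws would be `⊤`.
-/
lemma tendsto_iInf_innerProb
    (E : (n : ℕ) → ProbabilityMeasure (Obs dX dW) → Set (Fin n → Obs dX dW))
    (h : Tendsto (fun n => ⨆ P ∈ M.laws, sampleLaw n P (E n P)ᶜ) atTop (𝓝 0)) :
    Tendsto (fun n => ⨅ P ∈ M.laws, innerProb (sampleLaw n P) (E n P)) atTop (𝓝 1) := by
  have h1 : Tendsto (fun n => 1 - ⨆ P ∈ M.laws, sampleLaw n P (E n P)ᶜ) atTop (𝓝 1) := by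
    simpa using ENNReal.Tendsto.sub tendsto_const_nhds h (Or.inl ENNReal.one_ne_top)
  refine tendsto_of_tendsto_of_tendsto_of_le_of_le h1 tendsto_const_nhds (fun n => ?_)
    (fun n => ?_)
  · exact le_iInf₂ fun P hP => tsub_le_tsub_left
      (le_iSup₂ (f := fun P (_ : P ∈ M.laws) => sampleLaw n P (E n P)ᶜ) P hP) 1
  · obtain ⟨P, hP⟩ := M.nonempty_laws
    exact (iInf₂_le P hP).trans tsub_le_self

end Model

end CondMoment

end

/-! ### Coverage and rate of convergence of the set estimate -/

theorem mainTheorem6 {dX dW dY d : ℕ} (M : CondMoment.Model dX dW dY d)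
    (hmeas : M.MeasurableClasses)
    (hg : M.InstrNonneg)
    (Y : ℝ) (hY : 0 ≤ Y) (hcov : M.CoveringBound Y) (hbdd : M.BoundedMoments Y)
    (S : (Fin dY → ℝ) → ℝ≥0) (hS : CondMoment.AdmissibleS S)
    (hcons : M.UniformlyDetectable)
    (mbar : ProbabilityMeasure (CondMoment.Obs dX dW) → CondMoment.Vec d → CondMoment.Vec dX →
      Fin dY → ℝ)
    (hmbar : M.IsCondMean mbar)
    (Dmbar : ProbabilityMeasure (CondMoment.Obs dX dW) → CondMoment.Vec d → CondMoment.Vec dX →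
      Fin dY → (CondMoment.Vec d →L[ℝ] ℝ))
    (hdiff : M.UniformlyDifferentiable mbar Dmbar)
    (α : ℝ) (hα : 0 < α) (hx₀ : M.ContactPoints α mbar Dmbar)
    (hsupp : M.SupportMass) (hrich : M.RichInstr)
    (ω : (n : ℕ) → (Fin n → CondMoment.Obs dX dW) → CondMoment.Vec d → CondMoment.Instr dX dY →
      Fin dY → ℝ)
    (ωlo ωup : ℝ) (hωlo : 0 < ωlo)
    (hω : ∀ n z, ∀ θ ∈ M.Θ, ∀ g ∈ M.𝒢, ∀ j, ωlo ≤ ω n z θ g j ∧ ω n z θ g j ≤ ωup)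
    (c : (n : ℕ) → (Fin n → CondMoment.Obs dX dW) → ℝ)
    (hc : M.TendsToInfty c) (hc' : M.NegligibleToSqrt c) :
    Tendsto (fun n : ℕ => ⨅ P ∈ M.laws, CondMoment.innerProb (CondMoment.sampleLaw n P)
        {z | M.identifiedSet P ⊆ M.setEstimate S (ω n z) z (c n z)}) atTop (𝓝 1) ∧
    ∃ B₀ : ℝ, ∀ B ≥ B₀,
      Tendsto (fun n : ℕ => ⨆ P ∈ M.laws, CondMoment.sampleLaw n P
        {z | ENNReal.ofReal B <
          ((n : ℝ≥0∞) / ENNReal.ofReal (c n z ^ 2)) ^ (α / (2 * dX + 2 * α)) *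
            Metric.hausdorffEDist (M.setEstimate S (ω n z) z (c n z)) (M.identifiedSet P)})
        atTop (𝓝 0) := by
  obtain ⟨-, K₁, hK₁, K₂, hK₂, hSK⟩ := hS
  -- The maximum with `1` keeps `W` positive even when the weight bounds hold vacuously.
  set W : ℝ := max ωup 1
  have hW0 : 0 < W := lt_max_of_lt_right one_pos
  set δ : ℝ := K₁ / (2 * W) with hδ
  have hδ0 : 0 < δ := by positivity
  have hWδ : W * δ < K₁ := by
    have : W * δ = K₁ / 2 := by rw [hδ]; field_simp
    linarith
  have hsubset : ∀ P ∈ M.laws, ∀ n : ℕ, 0 < n → ∀ z, 0 < c n z →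
      z ∉ M.deviationSet P n (δ * c n z) →
      M.identifiedSet P ⊆ M.setEstimate S (ω n z) z (c n z) := fun P hP n hn z hcz hz =>
    CondMoment.Model.identifiedSet_subset_setEstimate hbdd hrich hg
      (fun a ha t => (hSK a ha t).1) hWδ hδ0.le
      (fun θ hθ g hg' j => ⟨hωlo.le.trans (hω n z θ hθ g hg' j).1,
        (hω n z θ hθ g hg' j).2.trans (le_max_left _ _)⟩) hP hn hcz hz
  obtain ⟨B₀, hB₀, ρ, hρ, hrate⟩ := CondMoment.Model.exists_infEDist_le hbdd hrich hg hcons hsupp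
    hmbar hdiff hα hx₀ (L := K₂ / ωlo + δ) (by positivity)
  refine ⟨CondMoment.Model.tendsto_iInf_innerProb
    (fun n P => {z | M.identifiedSet P ⊆ M.setEstimate S (ω n z) z (c n z)})
    (CondMoment.Model.tendsto_iSup_sampleLaw hmeas hcov hc hc' hδ0 one_pos _
      fun P hP n hn z hz hcz _ => ?_), B₀, fun B hB =>
    CondMoment.Model.tendsto_iSup_sampleLaw hmeas hcov hc hc' hδ0 hρ _
      fun P hP n hn z hz hcz hczρ => ?_⟩
  · by_contra hdev
    exact hz (hsubset P hP n hn z hcz hdev)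
  · by_contra hdev
    refine absurd (show ENNReal.ofReal B < _ from hz) (not_lt.2 ?_)
    refine le_trans ?_ (ENNReal.ofReal_le_ofReal hB)
    -- `B₀` is written as the normalising factor times the distance bound, so the factor cancels by
    -- monotonicity.
    rw [← CondMoment.Model.rate_mul_le hn hcz (α / (2 * dX + 2 * α)) B₀]
    gcongr
    refine Metric.hausdorffEDist_le_of_infEDist (fun θ hθ => ?_) fun θ hθ => ?_
    · exact hrate P hP θ hθ.1 _ (by positivity) hczρ fun g hg' j =>
        CondMoment.Model.neg_le_mu_of_mem_setEstimate hK₂.le (fun a ha t => (hSK a ha t).2) hωlo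
          (fun θ hθ g hg' j => (hω n z θ hθ g hg' j).1) hn hcz hdev hθ hg' j
    · rw [Metric.infEDist_zero_of_mem (hsubset P hP n hn z hcz hdev hθ)]
      exact zero_le
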